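/- Let $K\subset\mathbb R^3$ be a nondegenerate tetrahedron with barycentric coordinates $\lambda_1,\dots,\lambda_4$, bubble function $b_K=\lambda_1\lambda_2\lambda_3\lambda_4$, set of edges $\mathcal E(K)$ and set of faces $\mathcal F(K)$. Fix a unit tangent vector $\boldsymbol t$ of each edge and a unit normal vector $\boldsymbol n$ of each face. Let $\mathbb P_m$ denote the polynomials of total degree at most $m$ (so $\mathbb P_{-1}=\{0\}$). For $k\in\{1,2\}$ let $$\boldsymbol W_k(K)=\nabla\mathbb P_{k+1}(K)+\boldsymbol x\times\mathbb P_1(K;\mathbb R^3)+b_K\mathbb P_1(K;\mathbb R^3).$$ For a face $F$ with unit normal $\boldsymbol n$ let $\mathbb P_0(F;\mathbb R^2)$ be the constant vector fields tangential to $F$, and let $$\boldsymbol{RM}_{k-2}(F)=\mathbb P_0(F;\mathbb R^2)+(\boldsymbol n\times\boldsymbol x)\,\mathbb P_{k-2}(F),\qquad \boldsymbol{RT}(F)=\mathbb P_0(F;\mathbb R^2)+\boldsymbol x_F\,\mathbb P_0(F),$$ where $\boldsymbol x_F=\boldsymbol x-(\boldsymbol x\cdot\boldsymbol n)\boldsymbol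 n$ is the tangential part of the position vector. Then the following hold. 1. The sum defining $\boldsymbol W_k(K)$ is direct, and $\dim\boldsymbol W_1(K)=32$, $\dim\boldsymbol W_2(K)=42$. 2. The degrees of freedom $$\int_e\boldsymbol v\cdot\boldsymbol t\,q\,\mathrm ds\quad(q\in\mathbb P_k(e),\ e\in\mathcal E(K)),$$ $$\int_F(\boldsymbol v\times\boldsymbol n)\cdot\boldsymbol q\,\mathrm dS\quad(\boldsymbol q\in\boldsymbol{RM}_{k-2}(F),\ F\in\mathcal F(K)),$$ $$\int_F\big((\operatorname{curl}\boldsymbol v)\times\boldsymbol n\big)\cdot\boldsymbol q\,\mathrm dS\quad(\boldsymbol q\in\boldsymbol{RT}(F),\ F\in\mathcal F(K))$$ are unisolvent for $\boldsymbol W_k(K)$: for arbitrary linear functionals $\alpha_e$ on $\mathbb P_k(e)$, $\beta_F$ on $\boldsymbol{RM}_{k-2}(F)$ and $\gamma_F$ on $\boldsymbol{RT}(F)$ ($e\in\mathcal E(K)$, $F\in\mathcal F(K)$) there is exactly one $\boldsymbol v\in\boldsymbol W_k(K)$ whose three families of moments are $\alpha_e(q)$, $\beta_F(\boldsymbol q)$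 and $\gamma_F(\boldsymbol q)$, respectively. 3. The operator $\operatorname{curl}$ is injective on $\boldsymbol x\times\mathbb P_1(K;\mathbb R^3)+b_K\mathbb P_1(K;\mathbb R^3)$. -/

import Mathlib

open scoped Matrix

noncomputable section

namespace QuadCurl

/-- Points and vectors of `ℝ³`; lengths and angles are always taken through the dot product. -/
abbrev Vec : Type := Fin 3 → ℝ

/-- Real polynomials in the three coordinates. -/
abbrev Poly : Type := MvPolynomial (Fin 3) ℝ

/-- Polynomial vector fields on `ℝ³`. -/
abbrev PolyField : Type := Fin 3 → Poly

/-- `ℙ_m`: polynomials of total degree at most `m`; in particular `ℙ_m = 0` for `m < 0`. -/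
def polyDeg (m : ℤ) : Submodule ℝ Poly :=
  MvPolynomial.restrictSupport ℝ {s : Fin 3 →₀ ℕ | (s.degree : ℤ) ≤ m}

/-- `ℙ_m(ℝ³)`: vector fields whose components lie in `ℙ_m`. -/
def polyFieldDeg (m : ℤ) : Submodule ℝ PolyField :=
  Submodule.pi Set.univ fun _ => polyDeg m

/-- Value of a polynomial vector field at a point. -/
def evalField (v : PolyField) (x : Vec) : Vec := fun i => MvPolynomial.eval x (v i)

/-- The constant vector field with value `a`. -/
def constField (a : Vec) : PolyField := fun i => MvPolynomial.C (a i)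

/-- The position vector field `x`. -/
def posField : PolyField := fun i => MvPolynomial.X i

/-- The gradient. -/
def grad : Poly →ₗ[ℝ] PolyField :=
  LinearMap.pi fun i => (MvPolynomial.pderiv i).toLinearMap

/-- The partial derivative `∂_i v_j`. -/
def partialComp (i j : Fin 3) : PolyField →ₗ[ℝ] Poly :=
  (MvPolynomial.pderiv i).toLinearMap ∘ₗ LinearMap.proj j

/-- The curl. -/
def curl : PolyField →ₗ[ℝ] PolyField :=
  LinearMap.pi
    ![partialComp 1 2 - partialComp 2 1,
      partialComp 2 0 - partialComp 0 2,
      partialComp 0 1 - partialComp 1 0]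

/-- `p ↦ p w`, multiplication of a fixed vector field `w` by scalar polynomials. -/
def mulField (w : PolyField) : Poly →ₗ[ℝ] PolyField :=
  (LinearMap.toSpanSingleton Poly PolyField w).restrictScalars ℝ

/-! ### The tetrahedron

The tetrahedron `K` is given by its vertices `p 0, …, p 3`. The face with index `i` is the one
opposite to `p i`, with vertices `faceVertex p i 0`, `faceVertex p i 1`, `faceVertex p i 2`. The
edges are indexed by the pairs `i < j`. -/

/-- The vertices of the face opposite to `p i`. -/
def faceVertex (p : Fin 4 → Vec) (i : Fin 4) (j : Fin 3) : Vec := p (i.succAbove j)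

/-- The closed face opposite to `p i`. -/
def face (p : Fin 4 → Vec) (i : Fin 4) : Set Vec := convexHull ℝ (Set.range (faceVertex p i))

/-- The index type of the six edges. -/
abbrev Edge : Type := {e : Fin 4 × Fin 4 // e.1 < e.2}

/-- The closed edge with index `e`. -/
def edge (p : Fin 4 → Vec) (e : Edge) : Set Vec := segment ℝ (p e.1.1) (p e.1.2)

/-- `(b - a) × (c - a)` for the vertices `a, b, c` of the face opposite to `p i`; its length is
twice the area of the face. -/
def faceCross (p : Fin 4 → Vec) (i : Fin 4) : Vec :=
  (faceVertex p i 1 - faceVertex p i 0) ⨯₃ (faceVertex p i 2 - faceVertex p i 0)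

/-- The barycentric coordinate `λ_i`, as a polynomial: the affine function that vanishes on the
plane of the face opposite to `p i` and is `1` at `p i`. -/
def bary (p : Fin 4 → Vec) (i : Fin 4) : Poly :=
  MvPolynomial.C (((p i - faceVertex p i 0) ⬝ᵥ faceCross p i)⁻¹) *
    ∑ j : Fin 3, MvPolynomial.C (faceCross p i j) *
      (MvPolynomial.X j - MvPolynomial.C (faceVertex p i 0 j))

/-- The bubble function `b_K = λ₁ λ₂ λ₃ λ₄`. -/
def bubble (p : Fin 4 → Vec) : Poly := ∏ i, bary p i

/-! ### The shape functions -/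

/-- `∇ ℙ_{k+1}(K)`. -/
def gradSpace (k : ℕ) : Submodule ℝ PolyField := (polyDeg (k + 1)).map grad

/-- `x × ℙ₁(K; ℝ³)`. -/
def crossSpace : Submodule ℝ PolyField :=
  (polyFieldDeg 1).map ((crossProduct posField).restrictScalars ℝ)

/-- `b_K ℙ₁(K; ℝ³)`. -/
def bubbleSpace (p : Fin 4 → Vec) : Submodule ℝ PolyField :=
  (polyFieldDeg 1).map ((LinearMap.lsmul Poly PolyField (bubble p)).restrictScalars ℝ)

/-- `W_k(K) = ∇ ℙ_{k+1}(K) + x × ℙ₁(K; ℝ³) + b_K ℙ₁(K; ℝ³)`. -/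
def shapeSpace (p : Fin 4 → Vec) (k : ℕ) : Submodule ℝ PolyField :=
  gradSpace k ⊔ crossSpace ⊔ bubbleSpace p

/-! ### Test functions on edges and faces -/

/-- Restriction of scalar polynomials to a set. -/
def restrictPoly (S : Set Vec) : Poly →ₗ[ℝ] (S → ℝ) where
  toFun q x := MvPolynomial.eval x.1 q
  map_add' q r := by ext x; simp
  map_smul' c q := by ext x; simp

/-- Restriction of polynomial vector fields to a set. -/
def restrictField (S : Set Vec) : PolyField →ₗ[ℝ] (S → Vec) where
  toFun q x := evalField q x.1
  map_add' q r := by ext x i; simp [evalField]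
  map_smul' c q := by ext x i; simp [evalField]

/-- The constant vector fields orthogonal to `n`: for a plane with unit normal `n`, these are the
constant tangential fields `ℙ₀(F; ℝ²)`. -/
def tangConst (n : Vec) : Submodule ℝ PolyField where
  carrier := {q | ∃ a : Vec, a ⬝ᵥ n = 0 ∧ q = constField a}
  add_mem' := by
    rintro _ _ ⟨a, ha, rfl⟩ ⟨b, hb, rfl⟩
    exact ⟨a + b, by simp [add_dotProduct, ha, hb], by ext1 i; simp [constField]⟩
  zero_mem' := ⟨0, by simp, by ext1 i; simp [constField]⟩
  smul_mem' := by
    rintro c _ ⟨a, ha, rfl⟩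
    exact ⟨c • a, by simp [smul_dotProduct, ha],
      by ext1 i; simp [constField, MvPolynomial.smul_eq_C_mul]⟩

/-- `x^⊥ = n × x`. -/
def posPerp (n : Vec) : PolyField := constField n ⨯₃ posField

/-- The tangential part `x - (x · n) n` of the position vector, that is, the position vector
within a plane with unit normal `n`. -/
def posTang (n : Vec) : PolyField := posField - (posField ⬝ᵥ constField n) • constField n

/-- The polynomial tangential fields `ℙ₀ + x^⊥ ℙ_m` whose restrictions to a face with unit normal
`n` make up `RM_m(F)`. -/
def rmField (m : ℤ) (n : Vec) : Submodule ℝ PolyField :=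
  tangConst n ⊔ (polyDeg m).map (mulField (posPerp n))

/-- The polynomial tangential fields `ℙ₀ + x ℙ₀` whose restrictions to a face with unit normal
`n` make up `RT(F)`. -/
def rtField (n : Vec) : Submodule ℝ PolyField :=
  tangConst n ⊔ (polyDeg 0).map (mulField (posTang n))

/-- `ℙ_k(e)`, as a space of functions on the edge. -/
abbrev EdgeTest (p : Fin 4 → Vec) (k : ℕ) (e : Edge) : Submodule ℝ (edge p e → ℝ) :=
  (polyDeg k).map (restrictPoly (edge p e))

/-- `RM_m(F)`, as a space of tangential vector fields on the face with index `i` and unit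
normal `n`. -/
abbrev RMTest (p : Fin 4 → Vec) (m : ℤ) (i : Fin 4) (n : Vec) : Submodule ℝ (face p i → Vec) :=
  (rmField m n).map (restrictField (face p i))

/-- `RT(F)`, as a space of tangential vector fields on the face with index `i` and unit
normal `n`. -/
abbrev RTTest (p : Fin 4 → Vec) (i : Fin 4) (n : Vec) : Submodule ℝ (face p i → Vec) :=
  (rtField n).map (restrictField (face p i))

/-! ### Line and surface integrals -/

/-- The arc length integral `∫_e f ds`, through the affine parametrization of the edge. -/
def edgeIntegral (p : Fin 4 → Vec) (e : Edge) (f : Vec → ℝ) : ℝ :=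
  √((p e.1.2 - p e.1.1) ⬝ᵥ (p e.1.2 - p e.1.1)) *
    ∫ s in (0 : ℝ)..1, f (p e.1.1 + s • (p e.1.2 - p e.1.1))

/-- The surface integral `∫_F f dS`, through the affine parametrization of the face. -/
def faceIntegral (p : Fin 4 → Vec) (i : Fin 4) (f : Vec → ℝ) : ℝ :=
  √(faceCross p i ⬝ᵥ faceCross p i) *
    ∫ s in (0 : ℝ)..1, ∫ r in (0 : ℝ)..(1 - s),
      f (faceVertex p i 0 + s • (faceVertex p i 1 - faceVertex p i 0)
        + r • (faceVertex p i 2 - faceVertex p i 0))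

/-! ### The degrees of freedom -/

/-- `∫_e (v · t) q ds`. -/
def edgeDof (p : Fin 4 → Vec) (e : Edge) (t : Vec) (v : PolyField) (q : Poly) : ℝ :=
  edgeIntegral p e fun x => (evalField v x ⬝ᵥ t) * MvPolynomial.eval x q

/-- `∫_F (v × n) · q dS`. -/
def faceDof (p : Fin 4 → Vec) (i : Fin 4) (n : Vec) (v q : PolyField) : ℝ :=
  faceIntegral p i fun x => (evalField v x ⨯₃ n) ⬝ᵥ evalField q x

/-- `t e` is a unit vector tangential to the edge `e`, for every edge. -/
def IsUnitTangents (p : Fin 4 → Vec) (t : Edge → Vec) : Prop :=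
  ∀ e, t e ⬝ᵥ t e = 1 ∧ ∃ c : ℝ, t e = c • (p e.1.2 - p e.1.1)

/-- `n i` is a unit vector normal to the face with index `i`, for every face. -/
def IsUnitNormals (p : Fin 4 → Vec) (n : Fin 4 → Vec) : Prop :=
  ∀ i, n i ⬝ᵥ n i = 1 ∧ ∀ j l, n i ⬝ᵥ (faceVertex p i j - faceVertex p i l) = 0

/-- The three families of degrees of freedom are unisolvent for a space `W` of vector fields:
whatever values (depending linearly on the test function) are prescribed for the edge moments
against `ℙ_k(e)`, the face moments against `RM_{k-2}(F)` and the face moments of the curl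
against `RT(F)`, exactly one element of `W` attains them. -/
def Unisolvent (p : Fin 4 → Vec) (k : ℕ) (t : Edge → Vec) (n : Fin 4 → Vec)
    (W : Submodule ℝ PolyField) : Prop :=
  ∀ (α : ∀ e : Edge, Module.Dual ℝ (EdgeTest p k e))
    (β : ∀ i : Fin 4, Module.Dual ℝ (RMTest p ((k : ℤ) - 2) i (n i)))
    (γ : ∀ i : Fin 4, Module.Dual ℝ (RTTest p i (n i))),
    ∃! v : PolyField, v ∈ W ∧
      (∀ (e : Edge) (q : polyDeg (k : ℤ)),
        edgeDof p e (t e) v q = α e ((restrictPoly (edge p e)).submoduleMap _ q)) ∧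
      (∀ (i : Fin 4) (q : rmField ((k : ℤ) - 2) (n i)),
        faceDof p i (n i) v q = β i ((restrictField (face p i)).submoduleMap _ q)) ∧
      (∀ (i : Fin 4) (q : rtField (n i)),
        faceDof p i (n i) (curl v) q = γ i ((restrictField (face p i)).submoduleMap _ q))

end QuadCurl

end

/-!
The argument rests on two facts about the bubble function. On a face with index `i`, where
`b_K = 0`, the curl of `b_K u` is the tangential field `b_F ∇λ_i × u`, where `b_F` is the product of
the three other barycentric coordinates (`evalField_curl_bubble_smul`); and `b_K u` itself does not
contribute to the edge moments nor to the face moments of the tangential trace.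

*Injectivity of the curl and directness.* If `curl (x × w + b_K u) = 0`, then the normal component
of the affine field `curl (x × w)` vanishes on every face, hence so does the field at every vertex,
and everywhere. An affine `w` with `curl (x × w) = 0` is a multiple of `x`
(`cross_eq_zero_of_curl_eq_zero`), so `x × w = 0`. What is left is `∇λ_i × u = 0` on every face,
which makes `u` normal to three faces at each vertex, so `u = 0` (`eq_zero_of_curl_eq_zero`). As the
curl of a gradient vanishes, the sum of the three spaces is direct, and the dimensions follow from
those of the polynomial spaces and the kernels of `grad` and of `w ↦ x × w`.

*Unisolvence.* There are at most as many independent moments as the dimension of the space, so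
uniqueness suffices (`unisolvent_of_injective`). Let all moments of
`∇q + x × w + b_K u` vanish. The field `∇q + x × w` is quadratic, of the form `∑ μ_i μ_j V i j` in
barycentric coordinates `μ`. The edge moments give `V i i = 0` and `V i j · (p j - p i) = 0`
(`bernstein_orthogonal_edge`), and on each face the tangential moments remove the three numbers
that are left (`triangle_coeff_eq_zero`); for `k = 1`, where there are fewer moments, the missing
conditions come from the fact that the quadratic part of `∇q + x × w`, evaluated at `d`, is
orthogonal to `d`. So `V = 0`.
For `b_K u` the moments of the curl against `x - p j`, whose tangential part lies in `RT(F)`, become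
`∫_F b_F u · (x - p j)`. On the face `i` they amount to `∑_{m ≠ i} u(p m) · (p m - p j) = 0` for
`j ≠ i`, and for fixed `j` these sums force each of their terms to vanish
(`eq_zero_of_curl_moments`).
-/

noncomputable section

namespace QuadCurl

open MvPolynomial

/-! ### Polynomials of bounded degree -/

theorem polyDeg_mono {a b : ℤ} (h : a ≤ b) : polyDeg a ≤ polyDeg b :=
  restrictSupport_mono ℝ fun _ hs => le_trans hs h

theorem mem_polyFieldDeg {m : ℤ} {v : PolyField} : v ∈ polyFieldDeg m ↔ ∀ i, v i ∈ polyDeg m := by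
  simp [polyFieldDeg, Submodule.mem_pi]

theorem C_mem_polyDeg {m : ℤ} (hm : 0 ≤ m) (c : ℝ) : (C c : Poly) ∈ polyDeg m := by
  rw [C_apply, polyDeg, monomial_mem_restrictSupport]
  exact Or.inl (by simpa using hm)

theorem X_mem_polyDeg {m : ℤ} (hm : 1 ≤ m) (i : Fin 3) : (X i : Poly) ∈ polyDeg m := by
  rw [X, polyDeg, monomial_mem_restrictSupport]
  exact Or.inl (by simpa using hm)

theorem mul_mem_polyDeg {a b : ℤ} {f g : Poly} (hf : f ∈ polyDeg a) (hg : g ∈ polyDeg b) :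
    f * g ∈ polyDeg (a + b) := by
  have h := Submodule.mul_mem_mul hf hg
  rw [polyDeg, polyDeg, ← restrictSupport_add] at h
  refine restrictSupport_mono ℝ ?_ h
  rintro _ ⟨s, hs, t, ht, rfl⟩
  simp only [Set.mem_ofPred_eq, map_add, Nat.cast_add] at *
  exact add_le_add hs ht

theorem exists_eq_add_single {s : Fin 3 →₀ ℕ} (hs : s ≠ 0) :
    ∃ i t, s = Finsupp.single i 1 + t := by
  obtain ⟨i, hi⟩ := Finsupp.ne_iff.1 hs
  refine ⟨i, s - Finsupp.single i 1, (add_tsub_cancel_of_le ?_).symm⟩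
  rw [Finsupp.single_le_iff]
  exact Nat.one_le_iff_ne_zero.2 hi

theorem polyDeg_two_le : polyDeg 2 ≤ polyDeg 1 * polyDeg 1 := by
  rw [polyDeg, polyDeg, ← restrictSupport_add]
  refine restrictSupport_mono ℝ fun s hs => ?_
  by_cases h0 : s = 0
  · exact ⟨0, by simp, 0, by simp, by simp [h0]⟩
  · obtain ⟨i, t, rfl⟩ := exists_eq_add_single h0
    refine ⟨Finsupp.single i 1, by simp, t, ?_, rfl⟩
    simp only [Set.mem_ofPred_eq, map_add, Nat.cast_add, Finsupp.degree_single] at hs ⊢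
    push_cast at hs
    linarith

theorem exists_affine_form {f : Poly} (hf : f ∈ polyDeg 1) :
    ∃ (c : ℝ) (a : Fin 3 → ℝ), f = C c + ∑ j, C (a j) * X j := by
  rw [polyDeg, restrictSupport_eq_span] at hf
  induction hf using Submodule.span_induction with
  | mem f hf =>
    obtain ⟨s, hs, rfl⟩ := hf
    by_cases h0 : s = 0
    · exact ⟨1, 0, by simp [h0]⟩
    · obtain ⟨i, t, rfl⟩ := exists_eq_add_single h0
      have ht : t = 0 := by
        simp only [Set.mem_ofPred_eq, map_add, Nat.cast_add, Finsupp.degree_single] at hs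
        rw [← Finsupp.degree_eq_zero_iff]
        push_cast at hs
        omega
      refine ⟨0, Pi.single i 1, ?_⟩
      rw [Finset.sum_eq_single i]
      · simp [ht, X]
      · intro j _ hj
        simp [hj]
      · simp
  | zero => exact ⟨0, 0, by simp⟩
  | add f g _ _ hf hg =>
    obtain ⟨c, a, rfl⟩ := hf
    obtain ⟨d, b, rfl⟩ := hg
    exact ⟨c + d, a + b, by simp [add_mul, Finset.sum_add_distrib]; ring⟩
  | smul r f _ hf =>
    obtain ⟨c, a, rfl⟩ := hf
    exact ⟨r * c, r • a, by simp [smul_eq_C_mul, Finset.mul_sum, mul_assoc]⟩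

theorem pderiv_mem_polyDeg {m : ℤ} {f : Poly} (hf : f ∈ polyDeg (m + 1)) (i : Fin 3) :
    pderiv i f ∈ polyDeg m := by
  rw [polyDeg, mem_restrictSupport_iff] at hf ⊢
  intro s hs
  have hs' : s + Finsupp.single i 1 ∈ f.support := by
    rw [mem_support_iff]
    intro h
    rw [Finset.mem_coe, mem_support_iff, coeff_pderiv, h] at hs
    simp at hs
  have := hf hs'
  simp only [Set.mem_ofPred_eq, map_add, Nat.cast_add, Finsupp.degree_single] at this ⊢
  push_cast at this
  linarith

theorem grad_mem_polyFieldDeg {m : ℤ} {q : Poly} (hq : q ∈ polyDeg (m + 1)) :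
    grad q ∈ polyFieldDeg m :=
  mem_polyFieldDeg.2 fun i => pderiv_mem_polyDeg hq i

theorem curl_eq (v : PolyField) : curl v =
    ![pderiv 1 (v 2) - pderiv 2 (v 1), pderiv 2 (v 0) - pderiv 0 (v 2),
      pderiv 0 (v 1) - pderiv 1 (v 0)] := by
  ext1 i
  fin_cases i <;> rfl

theorem curl_mem_polyFieldDeg {m : ℤ} {v : PolyField} (hv : v ∈ polyFieldDeg (m + 1)) :
    curl v ∈ polyFieldDeg m := by
  rw [mem_polyFieldDeg] at *
  have h (i j : Fin 3) : pderiv i (v j) ∈ polyDeg m := pderiv_mem_polyDeg (hv j) i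
  rw [curl_eq]
  simpa [Fin.forall_fin_succ] using
    And.intro (sub_mem (h 1 2) (h 2 1))
      (And.intro (sub_mem (h 2 0) (h 0 2)) (sub_mem (h 0 1) (h 1 0)))

theorem cross_mem_polyFieldDeg {w : PolyField} (hw : w ∈ polyFieldDeg 1) :
    posField ⨯₃ w ∈ polyFieldDeg 2 := by
  rw [mem_polyFieldDeg] at *
  have h (i j : Fin 3) : X i * w j ∈ polyDeg 2 := by
    rw [← one_add_one_eq_two]
    exact mul_mem_polyDeg (X_mem_polyDeg le_rfl i) (hw j)
  rw [cross_apply]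
  simpa [Fin.forall_fin_succ, posField] using
    And.intro (sub_mem (h 1 2) (h 2 1))
      (And.intro (sub_mem (h 2 0) (h 0 2)) (sub_mem (h 0 1) (h 1 0)))

/-! ### Evaluation and vector calculus of polynomial fields -/

@[simp] theorem evalField_add (v w : PolyField) (x : Vec) :
    evalField (v + w) x = evalField v x + evalField w x := by
  ext i; simp [evalField]

@[simp] theorem evalField_sub (v w : PolyField) (x : Vec) :
    evalField (v - w) x = evalField v x - evalField w x := by
  ext i; simp [evalField]

@[simp] theorem evalField_neg (v : PolyField) (x : Vec) :
    evalField (-v) x = -evalField v x := by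
  ext i; simp [evalField]

@[simp] theorem evalField_smul (c : ℝ) (v : PolyField) (x : Vec) :
    evalField (c • v) x = c • evalField v x := by
  ext i; simp [evalField]

@[simp] theorem evalField_polySmul (f : Poly) (v : PolyField) (x : Vec) :
    evalField (f • v) x = eval x f • evalField v x := by
  ext i; simp [evalField]

@[simp] theorem evalField_zero (x : Vec) : evalField 0 x = 0 := by
  ext i; simp [evalField]

@[simp] theorem evalField_posField (x : Vec) : evalField posField x = x := by
  ext i; simp [evalField, posField]

@[simp] theorem evalField_constField (a x : Vec) : evalField (constField a) x = a := by
  ext i; simp [evalField, constField]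

@[simp] theorem evalField_cross (v w : PolyField) (x : Vec) :
    evalField (v ⨯₃ w) x = evalField v x ⨯₃ evalField w x := by
  ext i; fin_cases i <;> simp [evalField, cross_apply]

theorem eval_dotProduct (v w : PolyField) (x : Vec) :
    eval x (v ⬝ᵥ w) = evalField v x ⬝ᵥ evalField w x := by
  simp [evalField, dotProduct]

theorem evalField_injective {v w : PolyField} (h : ∀ x, evalField v x = evalField w x) : v = w := by
  ext1 i
  exact MvPolynomial.funext fun x => congrFun (h x) i

theorem curl_smul (b : Poly) (u : PolyField) :
    curl (b • u) = grad b ⨯₃ u + b • curl u := by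
  ext1 i
  fin_cases i <;> simp [curl, grad, partialComp, cross_apply] <;> ring

theorem curl_grad (q : Poly) : curl (grad q) = 0 := by
  have h (i j : Fin 3) : pderiv i (pderiv j q) = pderiv j (pderiv i q) := by
    ext s
    simp only [coeff_pderiv, add_right_comm s (Finsupp.single i 1)]
    by_cases hij : i = j
    · subst hij; ring
    · simp [hij, Ne.symm hij]
      ring
  ext1 i
  fin_cases i <;> simp [curl, grad, partialComp, sub_eq_zero] <;> exact h _ _

theorem grad_mul (f g : Poly) : grad (f * g) = f • grad g + g • grad f := by
  ext1 i
  simp [grad]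

/-- For affine `w = c + A x` one has `curl (x × w) = (tr A) x - 2 c - 3 A x`; hence the curl
vanishes only when `w` is a multiple of `x`. -/
theorem cross_eq_zero_of_curl_eq_zero {w : PolyField} (hw : w ∈ polyFieldDeg 1)
    (h : curl (posField ⨯₃ w) = 0) : ∃ r : ℝ, w = r • posField := by
  rw [mem_polyFieldDeg] at hw
  choose c a hca using fun i => exists_affine_form (hw i)
  have key (x : Vec) (i : Fin 3) :
      (∑ j, a j j) * x i - 2 * c i - 3 * ∑ j, a i j * x j = 0 := by
    trans eval x (curl (posField ⨯₃ w) i)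
    swap
    · simp [h]
    fin_cases i <;>
      simp [curl, partialComp, cross_apply, posField, hca, Fin.sum_univ_three, pderiv_X] <;> ring
  refine ⟨(∑ j, a j j) / 3, evalField_injective fun x => ?_⟩
  ext i
  have h0 := key 0 i
  have h1 := key x i
  simp only [Pi.zero_apply, mul_zero, Finset.sum_const_zero] at h0
  simp only [evalField_smul, evalField_posField, Pi.smul_apply, smul_eq_mul]
  simp only [evalField, hca, map_add, map_sum, map_mul, eval_C, eval_X]
  linarith

/-! ### Barycentric coordinates of the tetrahedron -/

/-- The point `∑ μ_j p_j`; for `∑ μ_j = 1` this is the point with barycentric coordinates `μ`. -/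
def baryPoint (p : Fin 4 → Vec) (μ : Fin 4 → ℝ) : Vec := ∑ j, μ j • p j

/-- The (constant) gradient of the barycentric coordinate `λ_i`. -/
def baryGrad (p : Fin 4 → Vec) (i : Fin 4) : Vec :=
  ((p i - faceVertex p i 0) ⬝ᵥ faceCross p i)⁻¹ • faceCross p i

theorem eval_bary (p : Fin 4 → Vec) (i : Fin 4) (x : Vec) :
    eval x (bary p i) = baryGrad p i ⬝ᵥ (x - faceVertex p i 0) := by
  simp [bary, baryGrad, dotProduct, Fin.sum_univ_three]
  ring

theorem bary_mem_polyDeg (p : Fin 4 → Vec) (i : Fin 4) : bary p i ∈ polyDeg 1 := by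
  have h0 (c : ℝ) : C c ∈ polyDeg 0 := C_mem_polyDeg le_rfl c
  rw [bary, ← zero_add (1 : ℤ)]
  refine mul_mem_polyDeg (h0 _) (sum_mem fun j _ => ?_)
  rw [← zero_add (1 : ℤ)]
  exact mul_mem_polyDeg (h0 _)
    (sub_mem (X_mem_polyDeg (by norm_num) j) (C_mem_polyDeg (by norm_num) _))

theorem grad_bary (p : Fin 4 → Vec) (i : Fin 4) : grad (bary p i) = constField (baryGrad p i) := by
  ext1 l
  fin_cases l <;> simp [grad, bary, baryGrad, constField, Fin.sum_univ_three, pderiv_X]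

theorem faceCross_dotProduct (p : Fin 4 → Vec) (i : Fin 4) (j : Fin 3) :
    faceCross p i ⬝ᵥ (faceVertex p i j - faceVertex p i 0) = 0 := by
  fin_cases j <;> simp [faceCross, cross_apply, dotProduct, Fin.sum_univ_three] <;> ring

variable {p : Fin 4 → Vec}

/-- The determinant in the definition of `bary` is nonzero, so the inverse there is not a junk
value. -/
theorem faceCross_triple_ne_zero (hp : AffineIndependent ℝ p) (i : Fin 4) :
    (p i - faceVertex p i 0) ⬝ᵥ faceCross p i ≠ 0 := by
  intro h
  rw [faceCross, triple_product_eq_det] at h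
  obtain ⟨v, hv, h⟩ := Matrix.exists_vecMul_eq_zero_iff.2 h
  rw [affineIndependent_iff] at hp
  -- A row relation of the determinant is an affine relation of the vertices.
  have key := hp Finset.univ (i.insertNth (v 0) ![-(v 0 + v 1 + v 2), v 1, v 2])
    (by rw [Fin.sum_univ_succAbove _ i]; simp [Fin.sum_univ_three]; ring)
    (by
      rw [Fin.sum_univ_succAbove _ i]
      ext l
      have := congrFun h l
      simp [Matrix.vecMul, dotProduct, Fin.sum_univ_three, faceVertex] at this ⊢
      linarith)
  apply hv
  have h0 := key i (Finset.mem_univ _)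
  have h1 := key (i.succAbove 1) (Finset.mem_univ _)
  have h2 := key (i.succAbove 2) (Finset.mem_univ _)
  simp only [Fin.insertNth_apply_same, Fin.insertNth_apply_succAbove] at h0 h1 h2
  ext l
  fin_cases l
  exacts [h0, h1, h2]

theorem eval_bary_vertex (hp : AffineIndependent ℝ p) (i j : Fin 4) :
    eval (p j) (bary p i) = (Pi.single j 1 : Fin 4 → ℝ) i := by
  rw [eval_bary]
  rcases Fin.eq_self_or_eq_succAbove i j with rfl | ⟨l, rfl⟩
  · rw [baryGrad, smul_dotProduct, dotProduct_comm, smul_eq_mul, Pi.single_eq_same]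
    rw [dotProduct_comm]
    exact inv_mul_cancel₀ (faceCross_triple_ne_zero hp j)
  · rw [Pi.single_eq_of_ne (Fin.succAbove_ne i l).symm, baryGrad, smul_dotProduct]
    exact smul_eq_zero_of_right _ (faceCross_dotProduct p i l)

theorem eval_baryPoint {f : Poly} (hf : f ∈ polyDeg 1) {μ : Fin 4 → ℝ} (hμ : ∑ j, μ j = 1) :
    eval (baryPoint p μ) f = ∑ j, μ j * eval (p j) f := by
  obtain ⟨c, a, rfl⟩ := exists_affine_form hf
  rw [Fin.sum_univ_four] at hμ
  simp only [baryPoint, map_add, eval_C, Fin.sum_univ_three, map_mul, eval_X, Fin.sum_univ_four,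
    Pi.add_apply, Pi.smul_apply, smul_eq_mul]
  linear_combination (-c) * hμ

theorem evalField_baryPoint {u : PolyField} (hu : u ∈ polyFieldDeg 1) {μ : Fin 4 → ℝ}
    (hμ : ∑ j, μ j = 1) : evalField u (baryPoint p μ) = ∑ j, μ j • evalField u (p j) := by
  ext i
  simpa [evalField] using eval_baryPoint (mem_polyFieldDeg.1 hu i) hμ

theorem eval_bary_baryPoint (hp : AffineIndependent ℝ p) {μ : Fin 4 → ℝ} (hμ : ∑ j, μ j = 1)
    (i : Fin 4) : eval (baryPoint p μ) (bary p i) = μ i := by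
  rw [eval_baryPoint (bary_mem_polyDeg p i) hμ]
  simp [eval_bary_vertex hp, Pi.single_apply]

theorem exists_eq_baryPoint (hp : AffineIndependent ℝ p) (x : Vec) :
    ∃ μ : Fin 4 → ℝ, ∑ j, μ j = 1 ∧ x = baryPoint p μ := by
  have htop : affineSpan ℝ (Set.range p) = ⊤ := by
    rw [hp.affineSpan_eq_top_iff_card_eq_finrank_add_one]
    simp
  let b : AffineBasis (Fin 4) ℝ Vec := ⟨p, hp, htop⟩
  exact ⟨fun j => b.coord j x, b.sum_coord_apply_eq_one x,
    (b.linear_combination_coord_eq_self x).symm⟩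

/-- The differences of the barycentric coordinates of `y` and of the origin are the numbers
`∇λ_i · y`. -/
theorem sum_baryGrad_smul (hp : AffineIndependent ℝ p) (y : Vec) :
    ∑ i, (baryGrad p i ⬝ᵥ y) • p i = y ∧ ∑ i, baryGrad p i ⬝ᵥ y = 0 := by
  obtain ⟨μ, hμ, hy⟩ := exists_eq_baryPoint hp y
  obtain ⟨ν, hν, h0⟩ := exists_eq_baryPoint hp 0
  have h (i : Fin 4) : baryGrad p i ⬝ᵥ y = μ i - ν i := by
    rw [← eval_bary_baryPoint hp hμ i, ← eval_bary_baryPoint hp hν i, ← hy, ← h0, eval_bary,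
      eval_bary, ← dotProduct_sub]
    simp
  simp only [h, sub_smul, Finset.sum_sub_distrib, hμ, hν, sub_self, and_true]
  change baryPoint p μ - baryPoint p ν = y
  rw [← hy, ← h0, sub_zero]

theorem dotProduct_eq_sum_baryGrad (hp : AffineIndependent ℝ p) (v y : Vec) :
    v ⬝ᵥ y = ∑ i, (baryGrad p i ⬝ᵥ y) * (v ⬝ᵥ p i) := by
  conv_lhs => rw [← (sum_baryGrad_smul hp y).1]
  simp only [dotProduct, Finset.sum_apply, Pi.smul_apply, smul_eq_mul,
    Fin.sum_univ_four, Fin.sum_univ_three]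
  ring

/-- The gradients of the barycentric coordinates of the three faces that meet at `p j` span the
space. -/
theorem eq_zero_of_baryGrad_dotProduct (hp : AffineIndependent ℝ p) {y : Vec} (j : Fin 4)
    (h : ∀ i, i ≠ j → baryGrad p i ⬝ᵥ y = 0) : y = 0 := by
  obtain ⟨h1, h2⟩ := sum_baryGrad_smul hp y
  have hj : baryGrad p j ⬝ᵥ y = 0 := by
    rwa [Finset.sum_eq_single j (fun i _ hi => h i hi) (by simp)] at h2
  rw [← h1]
  refine Finset.sum_eq_zero fun i _ => ?_
  by_cases hi : i = j
  · rw [hi, hj, zero_smul]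
  · rw [h i hi, zero_smul]

/-- The three edges that meet at `p j` span the space. -/
theorem eq_zero_of_dotProduct_edges (hp : AffineIndependent ℝ p) {y : Vec} (j : Fin 4)
    (h : ∀ l, l ≠ j → y ⬝ᵥ (p l - p j) = 0) : y = 0 := by
  have h' (l : Fin 4) : y ⬝ᵥ p l = y ⬝ᵥ p j := by
    by_cases hl : l = j
    · rw [hl]
    · rw [← sub_eq_zero, ← dotProduct_sub, h l hl]
  have : y ⬝ᵥ y = 0 := by
    rw [dotProduct_eq_sum_baryGrad hp]
    simp only [h']
    rw [← Finset.sum_mul, (sum_baryGrad_smul hp y).2, zero_mul]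
  exact dotProduct_self_eq_zero.1 this

theorem baryGrad_dotProduct_face (hp : AffineIndependent ℝ p) {i l m : Fin 4} (hl : l ≠ i)
    (hm : m ≠ i) : baryGrad p i ⬝ᵥ (p l - p m) = 0 := by
  have h1 := eval_bary_vertex hp i l
  have h2 := eval_bary_vertex hp i m
  rw [Pi.single_eq_of_ne hl.symm] at h1
  rw [Pi.single_eq_of_ne hm.symm] at h2
  rw [eval_bary] at h1 h2
  rw [← sub_sub_sub_cancel_right _ _ (faceVertex p i 0), dotProduct_sub, h1, h2, sub_zero]

theorem baryGrad_ne_zero (hp : AffineIndependent ℝ p) (i : Fin 4) : baryGrad p i ≠ 0 := by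
  intro h
  have h1 := eval_bary_vertex hp i i
  simp [eval_bary, h] at h1

/-- Every unit normal of a face is a nonzero multiple of the gradient of the barycentric
coordinate that vanishes on the face. -/
theorem exists_normal_eq_smul_baryGrad (hp : AffineIndependent ℝ p) {n : Fin 4 → Vec}
    (hn : IsUnitNormals p n) (i : Fin 4) : ∃ c : ℝ, c ≠ 0 ∧ n i = c • baryGrad p i := by
  obtain ⟨hn1, hn2⟩ := hn i
  have key : n i = (n i ⬝ᵥ (p i - faceVertex p i 0)) • baryGrad p i := by
    refine dotProduct_eq _ _ fun y => ?_
    have h (l : Fin 3) : n i ⬝ᵥ p (i.succAbove l) = n i ⬝ᵥ faceVertex p i 0 := by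
      rw [← sub_eq_zero, ← dotProduct_sub]
      exact hn2 l 0
    have h0 := (sum_baryGrad_smul hp y).2
    rw [Fin.sum_univ_succAbove _ i] at h0
    rw [dotProduct_eq_sum_baryGrad hp, Fin.sum_univ_succAbove _ i]
    simp only [h]
    rw [← Finset.sum_mul, smul_dotProduct, dotProduct_sub, smul_eq_mul]
    linear_combination (n i ⬝ᵥ faceVertex p i 0) * h0
  refine ⟨_, fun h0 => ?_, key⟩
  rw [h0, zero_smul] at key
  rw [key] at hn1
  simp at hn1

/-! ### The bubble function -/

theorem bubble_eq (p : Fin 4 → Vec) (i : Fin 4) :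
    bubble p = bary p i * ∏ j, bary p (i.succAbove j) := by
  rw [bubble, Fin.prod_univ_succAbove _ i]

/-- The product of the three barycentric coordinates of the face opposite to `p i`. -/
def faceBubble (p : Fin 4 → Vec) (i : Fin 4) : Poly := ∏ j, bary p (i.succAbove j)

theorem eval_bubble_of_face {i : Fin 4} {x : Vec} (hx : eval x (bary p i) = 0) :
    eval x (bubble p) = 0 := by
  rw [bubble_eq p i, map_mul, hx, zero_mul]

/-- On a face the curl of `b_K u` is the tangential field `b_F ∇λ_i × u`. -/
theorem evalField_curl_bubble_smul {i : Fin 4} {x : Vec} (hx : eval x (bary p i) = 0)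
    (u : PolyField) : evalField (curl (bubble p • u)) x =
      eval x (faceBubble p i) • baryGrad p i ⨯₃ evalField u x := by
  rw [curl_smul, evalField_add, evalField_polySmul, eval_bubble_of_face hx, zero_smul, add_zero,
    evalField_cross, bubble_eq p i, grad_mul, evalField_add, evalField_polySmul,
    evalField_polySmul, hx, zero_smul, zero_add, grad_bary, evalField_constField, map_smul,
    LinearMap.smul_apply]
  rfl

theorem bubble_ne_zero (hp : AffineIndependent ℝ p) : bubble p ≠ 0 := by
  rw [bubble, Finset.prod_ne_zero_iff]
  intro i _ h
  have := eval_bary_vertex hp i i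
  simp [h] at this

/-! ### Injectivity of the curl -/

theorem eq_zero_of_evalField_vertices (hp : AffineIndependent ℝ p) {u : PolyField}
    (hu : u ∈ polyFieldDeg 1) (h : ∀ j, evalField u (p j) = 0) : u = 0 := by
  refine evalField_injective fun x => ?_
  obtain ⟨μ, hμ, rfl⟩ := exists_eq_baryPoint hp x
  rw [evalField_baryPoint hu hμ, evalField_zero]
  simp [h]

/-- A vector field of the form `b_K u` with `u` affine is determined by its curl: on a face the
curl is `b_F ∇λ_i × u`, so `u` is normal to the three faces meeting at a vertex. -/
theorem eq_zero_of_curl_bubble_smul (hp : AffineIndependent ℝ p) {u : PolyField}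
    (hu : u ∈ polyFieldDeg 1) (h : curl (bubble p • u) = 0) : u = 0 := by
  have interior (i : Fin 4) (μ : Fin 4 → ℝ) (hμ : ∑ j, μ j = 1) (hi : μ i = 0)
      (h0 : ∀ l, l ≠ i → μ l ≠ 0) : baryGrad p i ⨯₃ evalField u (baryPoint p μ) = 0 := by
    have hx : eval (baryPoint p μ) (bary p i) = 0 := by rw [eval_bary_baryPoint hp hμ, hi]
    have h1 := evalField_curl_bubble_smul hx u
    rw [h, evalField_zero, eq_comm, smul_eq_zero] at h1
    refine h1.resolve_left ?_
    rw [faceBubble, map_prod, ← ne_eq, Finset.prod_ne_zero_iff]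
    intro l _
    rw [eval_bary_baryPoint hp hμ]
    exact h0 _ (Fin.succAbove_ne i l)
  have vertex (i j : Fin 4) (hij : i ≠ j) : baryGrad p i ⨯₃ evalField u (p j) = 0 := by
    -- The vertex is an affine combination of two interior points of the face, where `b_F ≠ 0`.
    let μ : Fin 4 → ℝ := fun l => if l = i then 0 else 1 / 4 + if l = j then 1 / 4 else 0
    let ν : Fin 4 → ℝ := fun l => if l = i then 0 else 1 / 3
    have hμ : ∑ l, μ l = 1 := by
      obtain ⟨m, rfl⟩ := Fin.exists_succAbove_eq hij.symm
      simp only [μ, Fin.sum_univ_succAbove _ i, if_true, Fin.succAbove_ne, if_false,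
        Fin.succAbove_right_inj]
      norm_num [Finset.sum_add_distrib]
    have hν : ∑ l, ν l = 1 := by
      simp [ν, Fin.sum_univ_succAbove _ i]
    have h1 := interior i μ hμ (by simp [μ]) (fun l hl => by
      by_cases hlj : l = j <;> simp [μ, hl, hlj, hij.symm])
    have h2 := interior i ν hν (by simp [ν]) (fun l hl => by simp [ν, hl])
    have h3 : evalField u (p j) =
        (4 : ℝ) • evalField u (baryPoint p μ) - (3 : ℝ) • evalField u (baryPoint p ν) := by
      rw [evalField_baryPoint hu hμ, evalField_baryPoint hu hν, Finset.smul_sum, Finset.smul_sum,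
        ← Finset.sum_sub_distrib, Finset.sum_eq_single j]
      · rw [smul_smul, smul_smul, ← sub_smul]
        norm_num [μ, ν, hij.symm]
      · intro l _ hl
        rw [smul_smul, smul_smul, ← sub_smul]
        by_cases hli : l = i
        · simp [μ, ν, hli]
        · norm_num [μ, ν, hl, hli]
      · simp
    rw [h3, map_sub, map_smul, map_smul, h1, h2]
    simp
  refine eq_zero_of_evalField_vertices hp hu fun j => ?_
  refine eq_zero_of_dotProduct_edges hp j fun l hl => ?_
  obtain ⟨i, hil, hij⟩ : ∃ i : Fin 4, i ≠ l ∧ i ≠ j := by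
    revert l j
    decide
  have h1 := congrArg (fun y => y ⨯₃ (p l - p j)) (vertex i j hij)
  simp only [LinearMap.map_zero₂] at h1
  have h2 := baryGrad_dotProduct_face hp hil.symm hij.symm
  have h3 : (evalField u (p j) ⬝ᵥ (p l - p j)) • baryGrad p i = 0 := by
    rwa [cross_cross_eq_smul_sub_smul, h2, zero_smul, zero_sub, neg_eq_zero] at h1
  exact (smul_eq_zero.1 h3).resolve_right (baryGrad_ne_zero hp i)

/-- The normal component of `curl (b_K u)` vanishes on every face, hence so does that of the affine
field `curl (x × w)` when the two curls cancel, and a field of this kind is zero. -/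
theorem eq_zero_of_curl_eq_zero (hp : AffineIndependent ℝ p) {w u : PolyField}
    (hw : w ∈ polyFieldDeg 1) (hu : u ∈ polyFieldDeg 1)
    (h : curl (posField ⨯₃ w + bubble p • u) = 0) : posField ⨯₃ w = 0 ∧ u = 0 := by
  rw [map_add] at h
  have h1 : curl (posField ⨯₃ w) = 0 := by
    have hdeg : curl (posField ⨯₃ w) ∈ polyFieldDeg 1 := by
      apply curl_mem_polyFieldDeg
      rw [one_add_one_eq_two]
      exact cross_mem_polyFieldDeg hw
    refine eq_zero_of_evalField_vertices hp hdeg fun j => ?_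
    refine eq_zero_of_baryGrad_dotProduct hp j fun i hij => ?_
    have hx : eval (p j) (bary p i) = 0 := by
      rw [eval_bary_vertex hp, Pi.single_eq_of_ne hij]
    have h2 := congrArg (fun v => evalField v (p j)) h
    simp only [evalField_add, evalField_curl_bubble_smul hx, evalField_zero] at h2
    rw [eq_neg_of_add_eq_zero_left h2, dotProduct_neg, dotProduct_smul, dot_self_cross, smul_zero,
      neg_zero]
  obtain ⟨r, rfl⟩ := cross_eq_zero_of_curl_eq_zero hw h1
  refine ⟨?_, eq_zero_of_curl_bubble_smul hp hu ?_⟩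
  · rw [LinearMap.map_smul_of_tower, cross_self, smul_zero]
  · rwa [h1, zero_add] at h

theorem mem_crossSpace {v : PolyField} :
    v ∈ crossSpace ↔ ∃ w ∈ polyFieldDeg 1, posField ⨯₃ w = v := Iff.rfl

theorem mem_bubbleSpace {v : PolyField} :
    v ∈ bubbleSpace p ↔ ∃ u ∈ polyFieldDeg 1, bubble p • u = v := Iff.rfl

theorem mem_gradSpace {k : ℕ} {v : PolyField} :
    v ∈ gradSpace k ↔ ∃ q ∈ polyDeg (k + 1), grad q = v := Iff.rfl

theorem curl_injOn (hp : AffineIndependent ℝ p) :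
    Set.InjOn curl (crossSpace ⊔ bubbleSpace p : Submodule ℝ PolyField) := by
  intro v hv w hw h
  obtain ⟨_, ⟨a, ha, rfl⟩, _, ⟨u, hu, rfl⟩, h1⟩ := Submodule.mem_sup.1 (sub_mem hv hw)
  change posField ⨯₃ a + bubble p • u = v - w at h1
  obtain ⟨h2, h3⟩ := eq_zero_of_curl_eq_zero hp ha hu (by rw [h1, map_sub, h, sub_self])
  rw [h2, h3, smul_zero, add_zero] at h1
  exact (sub_eq_zero.1 h1.symm)

theorem eq_zero_of_shape_add_eq_zero (hp : AffineIndependent ℝ p) {k : ℕ} {a b c : PolyField}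
    (ha : a ∈ gradSpace k) (hb : b ∈ crossSpace) (hc : c ∈ bubbleSpace p) (h : a + b + c = 0) :
    a = 0 ∧ b = 0 ∧ c = 0 := by
  obtain ⟨q, -, rfl⟩ := mem_gradSpace.1 ha
  obtain ⟨w, hw, rfl⟩ := mem_crossSpace.1 hb
  obtain ⟨u, hu, rfl⟩ := mem_bubbleSpace.1 hc
  have h1 := congrArg curl h
  rw [add_assoc, map_add, curl_grad, zero_add, map_zero] at h1
  obtain ⟨h2, h3⟩ := eq_zero_of_curl_eq_zero hp hw hu h1
  rw [h2, h3, smul_zero, add_zero, add_zero] at h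
  exact ⟨h, h2, by rw [h3, smul_zero]⟩

theorem iSupIndep_shape (hp : AffineIndependent ℝ p) (k : ℕ) :
    iSupIndep ![gradSpace k, crossSpace, bubbleSpace p] := by
  rw [iSupIndep_iff_finsetSum_eq_zero_imp_eq_zero]
  intro s v hv h0
  -- Extend the family by zero, so that all three summands are present.
  let v' : Fin 3 → PolyField := fun i => if i ∈ s then v i else 0
  have hv' (i : Fin 3) : v' i ∈ ![gradSpace k, crossSpace, bubbleSpace p] i := by
    by_cases hi : i ∈ s
    · simpa [v', hi] using hv i hi
    · simp [v', hi]
  have h1 : v' 0 + v' 1 + v' 2 = 0 := by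
    rw [← Fin.sum_univ_three, ← h0]
    simp [v']
  obtain ⟨h2, h3, h4⟩ := eq_zero_of_shape_add_eq_zero hp (hv' 0) (hv' 1) (hv' 2) h1
  intro i hi
  have : v' i = 0 := by fin_cases i <;> assumption
  simpa [v', hi] using this

/-! ### Dimensions -/

theorem polyDeg_finite_support (m : ℤ) : {s : Fin 3 →₀ ℕ | (s.degree : ℤ) ≤ m}.Finite := by
  refine (Finsupp.finite_of_degree_le (σ := Fin 3) m.toNat).subset fun s hs => ?_
  exact (Int.le_toNat (le_trans (by positivity) hs)).2 hs

instance (m : ℤ) : FiniteDimensional ℝ (polyDeg m) :=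
  haveI := (polyDeg_finite_support m).to_subtype
  (basisRestrictSupport ℝ {s : Fin 3 →₀ ℕ | (s.degree : ℤ) ≤ m}).finiteDimensional_of_finite

theorem finrank_polyDeg (m : ℕ) : Module.finrank ℝ (polyDeg m) = (m + 3).choose 3 := by
  have h1 : Module.finrank ℝ (polyDeg m) = {s : Fin 3 →₀ ℕ | (s.degree : ℤ) ≤ m}.ncard :=
    Module.finrank_eq_nat_card_basis (basisRestrictSupport ℝ _)
  have h2 : {s : Fin 3 →₀ ℕ | (s.degree : ℤ) ≤ m} =
      ((Finset.range (m + 1)).biUnion fun d => Finset.univ.finsuppAntidiag d :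
        Finset (Fin 3 →₀ ℕ)) := by
    ext s
    simp [Finsupp.degree_eq_sum]
    norm_cast
  rw [h1, h2, Set.ncard_coe_finset, Finset.card_biUnion]
  · clear h1 h2
    simp only [Finset.card_finsuppAntidiag_nat_eq_choose]
    induction m with
    | zero => simp
    | succ m ih =>
      have h : (Finset.univ : Finset (Fin 3)).card + (m + 1) - 1 = m + 3 := by
        rw [Finset.card_univ, Fintype.card_fin]
        omega
      rw [Finset.sum_range_succ, ih, h, add_right_comm m 1 3, Nat.choose_succ_succ' (m + 3) 2,
        add_comm]
      congr 1
      exact Nat.choose_symm_of_eq_add (by omega)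
  · intro a _ b _ hab
    rw [Function.onFun, Finset.disjoint_left]
    intro s hs ht
    rw [Finset.mem_finsuppAntidiag] at hs ht
    exact hab (hs.1.symm.trans ht.1)

theorem finrank_map_add_finrank_ker {V W : Type*} [AddCommGroup V] [Module ℝ V] [AddCommGroup W]
    [Module ℝ W] (f : V →ₗ[ℝ] W) (S : Submodule ℝ V) [FiniteDimensional ℝ S] :
    Module.finrank ℝ (S.map f) + Module.finrank ℝ (LinearMap.ker (f.domRestrict S)) =
      Module.finrank ℝ S := by
  rw [← LinearMap.range_domRestrict, LinearMap.finrank_range_add_finrank_ker]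

/-- `ℙ_m(ℝ³)` as the product of three copies of `ℙ_m`. -/
def polyFieldDegEquiv (m : ℤ) : polyFieldDeg m ≃ₗ[ℝ] (Fin 3 → polyDeg m) where
  toFun v i := ⟨v.1 i, mem_polyFieldDeg.1 v.2 i⟩
  invFun v := ⟨fun i => (v i).1, mem_polyFieldDeg.2 fun i => (v i).2⟩
  map_add' _ _ := rfl
  map_smul' _ _ := rfl
  left_inv _ := rfl
  right_inv _ := rfl

instance (m : ℤ) : FiniteDimensional ℝ (polyFieldDeg m) :=
  (polyFieldDegEquiv m).symm.finiteDimensional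

theorem finrank_polyFieldDeg_one : Module.finrank ℝ (polyFieldDeg 1) = 12 := by
  rw [(polyFieldDegEquiv 1).finrank_eq, Module.finrank_pi_fintype]
  have := finrank_polyDeg 1
  rw [Nat.cast_one] at this
  simp [this, Nat.choose]

theorem finrank_bubbleSpace (hp : AffineIndependent ℝ p) :
    Module.finrank ℝ (bubbleSpace p) = 12 := by
  rw [bubbleSpace, ← finrank_polyFieldDeg_one]
  refine (Submodule.equivMapOfInjective _ ?_ _).finrank_eq.symm
  intro u v huv
  exact smul_right_injective PolyField (bubble_ne_zero hp) huv

theorem finrank_crossSpace : Module.finrank ℝ crossSpace = 11 := by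
  have h := finrank_map_add_finrank_ker ((crossProduct posField).restrictScalars ℝ)
    (polyFieldDeg 1)
  have hx : posField ∈ polyFieldDeg 1 := mem_polyFieldDeg.2 fun i => X_mem_polyDeg le_rfl i
  have hker : LinearMap.ker (((crossProduct posField).restrictScalars ℝ).domRestrict
      (polyFieldDeg 1)) = Submodule.span ℝ {⟨posField, hx⟩} := by
    ext ⟨w, hw⟩
    rw [LinearMap.mem_ker, Submodule.mem_span_singleton]
    change posField ⨯₃ w = 0 ↔ _
    constructor
    · intro h0
      obtain ⟨r, hr⟩ := cross_eq_zero_of_curl_eq_zero hw (by rw [h0, map_zero])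
      exact ⟨r, Subtype.ext hr.symm⟩
    · rintro ⟨r, hr⟩
      obtain rfl : r • posField = w := congrArg Subtype.val hr
      rw [LinearMap.map_smul_of_tower, cross_self, smul_zero]
  rw [hker, finrank_span_singleton, finrank_polyFieldDeg_one] at h
  · exact Nat.succ.inj h
  · intro h0
    have := congrFun (congrArg Subtype.val h0) 0
    exact X_ne_zero (R := ℝ) (0 : Fin 3) this

theorem grad_eq_zero_iff {q : Poly} : grad q = 0 ↔ ∃ c, q = C c := by
  constructor
  · intro h
    refine ⟨coeff 0 q, ?_⟩
    ext s
    by_cases hs : s = 0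
    · simp [hs]
    · rw [coeff_C, if_neg (Ne.symm hs)]
      obtain ⟨i, t, rfl⟩ := exists_eq_add_single hs
      have h1 : coeff t (pderiv i q) = 0 := by
        rw [show pderiv i q = 0 from congrFun h i, coeff_zero]
      rw [coeff_pderiv, add_comm] at h1
      exact (mul_eq_zero.1 h1).resolve_right (by positivity)
  · rintro ⟨c, rfl⟩
    ext1 i
    simp [grad]

theorem finrank_gradSpace_add_one (k : ℕ) :
    Module.finrank ℝ (gradSpace k) + 1 = (k + 4).choose 3 := by
  have h := finrank_map_add_finrank_ker grad (polyDeg (k + 1))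
  have h1 : (1 : Poly) ∈ polyDeg (k + 1) := by
    rw [← C_1]
    exact C_mem_polyDeg (by positivity) 1
  have hker : LinearMap.ker (grad.domRestrict (polyDeg (k + 1))) =
      Submodule.span ℝ {⟨1, h1⟩} := by
    ext ⟨q, hq⟩
    rw [LinearMap.mem_ker, Submodule.mem_span_singleton]
    change grad q = 0 ↔ _
    rw [grad_eq_zero_iff]
    refine exists_congr fun c => ?_
    rw [Subtype.ext_iff]
    change q = C c ↔ c • 1 = q
    rw [smul_eq_C_mul, mul_one, eq_comm]
  rw [hker, finrank_span_singleton] at h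
  · rw [gradSpace, h]
    exact_mod_cast finrank_polyDeg (k + 1)
  · intro h0
    exact one_ne_zero (congrArg Subtype.val h0)

instance (k : ℕ) : FiniteDimensional ℝ (gradSpace k) := by
  unfold gradSpace; infer_instance

instance : FiniteDimensional ℝ crossSpace := by
  unfold crossSpace; infer_instance

instance : FiniteDimensional ℝ (bubbleSpace p) := by
  unfold bubbleSpace; infer_instance

instance (k : ℕ) : FiniteDimensional ℝ (shapeSpace p k) := by
  unfold shapeSpace; infer_instance

theorem finrank_shapeSpace (hp : AffineIndependent ℝ p) (k : ℕ) :
    Module.finrank ℝ (shapeSpace p k) = Module.finrank ℝ (gradSpace k) + 23 := by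
  have h1 : gradSpace k ⊓ crossSpace = ⊥ := by
    refine (Submodule.eq_bot_iff _).2 fun v hv => ?_
    exact (eq_zero_of_shape_add_eq_zero hp (k := k) (neg_mem hv.1) hv.2
      (zero_mem (bubbleSpace p)) (by simp)).2.1
  have h2 : (gradSpace k ⊔ crossSpace) ⊓ bubbleSpace p = ⊥ := by
    refine (Submodule.eq_bot_iff _).2 fun v hv => ?_
    obtain ⟨a, ha, b, hb, h⟩ := Submodule.mem_sup.1 hv.1
    have := (eq_zero_of_shape_add_eq_zero hp ha hb (neg_mem hv.2) (by simp [h])).2.2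
    exact neg_eq_zero.1 this
  have h3 := Submodule.finrank_sup_add_finrank_inf_eq (gradSpace k) crossSpace
  have h4 := Submodule.finrank_sup_add_finrank_inf_eq (gradSpace k ⊔ crossSpace) (bubbleSpace p)
  rw [h1, finrank_bot, finrank_crossSpace] at h3
  rw [h2, finrank_bot, finrank_bubbleSpace hp] at h4
  rw [shapeSpace]
  omega

/-! ### Linearity and locality of the degrees of freedom -/

theorem continuous_evalField (v : PolyField) : Continuous (evalField v) :=
  continuous_pi fun i => MvPolynomial.continuous_eval (v i)

theorem continuous_edgeIntegrand (v : PolyField) (t : Vec) (q : Poly) :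
    Continuous fun x => (evalField v x ⬝ᵥ t) * eval x q :=
  ((continuous_evalField v).dotProduct continuous_const).mul (MvPolynomial.continuous_eval q)

theorem continuous_faceIntegrand (v : PolyField) (n : Vec) (q : PolyField) :
    Continuous fun x => (evalField v x ⨯₃ n) ⬝ᵥ evalField q x := by
  have h (v : PolyField) (i : Fin 3) : Continuous fun x => evalField v x i :=
    (continuous_apply i).comp (continuous_evalField v)
  simp only [cross_apply, dotProduct, Fin.sum_univ_three, Matrix.cons_val]
  have := h v
  have := h q
  fun_prop

theorem edgeIntegral_add (e : Edge) {f g : Vec → ℝ} (hf : Continuous f) (hg : Continuous g) :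
    edgeIntegral p e (fun x => f x + g x) = edgeIntegral p e f + edgeIntegral p e g := by
  rw [edgeIntegral, intervalIntegral.integral_add, mul_add] <;> try rfl
  all_goals exact Continuous.intervalIntegrable (by fun_prop) _ _

theorem edgeIntegral_const_mul (e : Edge) (c : ℝ) (f : Vec → ℝ) :
    edgeIntegral p e (fun x => c * f x) = c * edgeIntegral p e f := by
  rw [edgeIntegral, intervalIntegral.integral_const_mul, mul_left_comm]
  rfl

theorem edgeIntegral_congr {e : Edge} {f g : Vec → ℝ} (h : ∀ x ∈ edge p e, f x = g x) :
    edgeIntegral p e f = edgeIntegral p e g := by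
  rw [edgeIntegral, edgeIntegral]
  congr 1
  refine intervalIntegral.integral_congr fun s hs => h _ ?_
  rw [Set.uIcc_of_le zero_le_one] at hs
  rw [edge, segment_eq_image']
  exact ⟨s, hs, rfl⟩

/-- The integral over the reference triangle with vertices `(0, 0)`, `(1, 0)`, `(0, 1)`. -/
def triangleIntegral (G : ℝ → ℝ → ℝ) : ℝ := ∫ s in (0 : ℝ)..1, ∫ r in (0 : ℝ)..(1 - s), G s r

theorem triangleIntegral_add {G H : ℝ → ℝ → ℝ} (hG : Continuous (Function.uncurry G))
    (hH : Continuous (Function.uncurry H)) :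
    triangleIntegral (fun s r => G s r + H s r) = triangleIntegral G + triangleIntegral H := by
  have hc {G : ℝ → ℝ → ℝ} (hG : Continuous (Function.uncurry G)) (s : ℝ) : Continuous (G s) :=
    hG.comp (Continuous.prodMk_right s)
  have hi {G : ℝ → ℝ → ℝ} (hG : Continuous (Function.uncurry G)) :
      Continuous fun s => ∫ r in (0 : ℝ)..(1 - s), G s r :=
    intervalIntegral.continuous_parametric_intervalIntegral_of_continuous hG (by fun_prop)
  rw [triangleIntegral, triangleIntegral, triangleIntegral, ← intervalIntegral.integral_add
    ((hi hG).intervalIntegrable _ _) ((hi hH).intervalIntegrable _ _)]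
  congr 1
  ext s
  exact intervalIntegral.integral_add ((hc hG s).intervalIntegrable _ _)
    ((hc hH s).intervalIntegrable _ _)

theorem triangleIntegral_const_mul (c : ℝ) (G : ℝ → ℝ → ℝ) :
    triangleIntegral (fun s r => c * G s r) = c * triangleIntegral G := by
  simp only [triangleIntegral, intervalIntegral.integral_const_mul]

theorem triangleIntegral_congr {G H : ℝ → ℝ → ℝ}
    (h : ∀ s r, 0 ≤ s → 0 ≤ r → s + r ≤ 1 → G s r = H s r) :
    triangleIntegral G = triangleIntegral H := by
  refine intervalIntegral.integral_congr fun s hs => ?_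
  rw [Set.uIcc_of_le zero_le_one] at hs
  refine intervalIntegral.integral_congr fun r hr => ?_
  rw [Set.uIcc_of_le (by linarith [hs.2])] at hr
  exact h s r hs.1 hr.1 (by linarith [hr.2])

/-- The parametrization of the face opposite to `p i` by the reference triangle. -/
def facePoint (p : Fin 4 → Vec) (i : Fin 4) (s r : ℝ) : Vec :=
  faceVertex p i 0 + s • (faceVertex p i 1 - faceVertex p i 0)
    + r • (faceVertex p i 2 - faceVertex p i 0)

theorem faceIntegral_eq (p : Fin 4 → Vec) (i : Fin 4) (f : Vec → ℝ) :
    faceIntegral p i f = √(faceCross p i ⬝ᵥ faceCross p i) *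
      triangleIntegral fun s r => f (facePoint p i s r) := rfl

theorem continuous_facePoint (i : Fin 4) :
    Continuous (Function.uncurry fun s r => facePoint p i s r) := by
  unfold facePoint Function.uncurry
  fun_prop

theorem facePoint_mem_face (i : Fin 4) {s r : ℝ} (hs : 0 ≤ s) (hr : 0 ≤ r) (h : s + r ≤ 1) :
    facePoint p i s r ∈ face p i := by
  have hmem (j : Fin 3) : faceVertex p i j ∈ face p i :=
    subset_convexHull ℝ _ (Set.mem_range_self j)
  have := (convex_convexHull ℝ (Set.range (faceVertex p i))).sum_mem (t := Finset.univ)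
    (w := ![1 - s - r, s, r]) (z := faceVertex p i)
    (by
      intro j _
      fin_cases j
      exacts [by simp; linarith, hs, hr])
    (by rw [Fin.sum_univ_three]; simp; ring) (fun j _ => hmem j)
  rw [Fin.sum_univ_three] at this
  have h' : facePoint p i s r = (1 - s - r) • faceVertex p i 0 + s • faceVertex p i 1
      + r • faceVertex p i 2 := by
    unfold facePoint
    module
  rw [h']
  exact this

theorem faceIntegral_add (i : Fin 4) {f g : Vec → ℝ} (hf : Continuous f) (hg : Continuous g) :
    faceIntegral p i (fun x => f x + g x) = faceIntegral p i f + faceIntegral p i g := by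
  rw [faceIntegral_eq, triangleIntegral_add, mul_add] <;> try rfl
  · exact hf.comp (continuous_facePoint i)
  · exact hg.comp (continuous_facePoint i)

theorem faceIntegral_const_mul (i : Fin 4) (c : ℝ) (f : Vec → ℝ) :
    faceIntegral p i (fun x => c * f x) = c * faceIntegral p i f := by
  rw [faceIntegral_eq, triangleIntegral_const_mul, mul_left_comm]
  rfl

theorem faceIntegral_congr {i : Fin 4} {f g : Vec → ℝ} (h : ∀ x ∈ face p i, f x = g x) :
    faceIntegral p i f = faceIntegral p i g := by
  rw [faceIntegral_eq, faceIntegral_eq]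
  congr 1
  exact triangleIntegral_congr fun s r hs hr hsr => h _ (facePoint_mem_face i hs hr hsr)

/-- The edge moments as a bilinear map. -/
def edgeDofBilin (p : Fin 4 → Vec) (e : Edge) (t : Vec) : PolyField →ₗ[ℝ] Poly →ₗ[ℝ] ℝ :=
  LinearMap.mk₂ ℝ (edgeDof p e t)
    (fun v w q => by
      simp only [edgeDof, evalField_add, add_dotProduct, add_mul]
      exact edgeIntegral_add e (continuous_edgeIntegrand v t q) (continuous_edgeIntegrand w t q))
    (fun c v q => by
      simp only [edgeDof, evalField_smul, smul_dotProduct, smul_eq_mul, mul_assoc]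
      exact edgeIntegral_const_mul e c _)
    (fun v q r => by
      simp only [edgeDof, map_add, mul_add]
      exact edgeIntegral_add e (continuous_edgeIntegrand v t q) (continuous_edgeIntegrand v t r))
    (fun c v q => by
      simp only [edgeDof, smul_eval, mul_left_comm _ c]
      exact edgeIntegral_const_mul e c _)

/-- The face moments as a bilinear map. -/
def faceDofBilin (p : Fin 4 → Vec) (i : Fin 4) (n : Vec) :
    PolyField →ₗ[ℝ] PolyField →ₗ[ℝ] ℝ :=
  LinearMap.mk₂ ℝ (faceDof p i n)
    (fun v w q => by
      simp only [faceDof, evalField_add, LinearMap.map_add₂, add_dotProduct]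
      exact faceIntegral_add i (continuous_faceIntegrand v n q) (continuous_faceIntegrand w n q))
    (fun c v q => by
      simp only [faceDof, evalField_smul, LinearMap.map_smul₂, smul_dotProduct, smul_eq_mul]
      exact faceIntegral_const_mul i c _)
    (fun v q r => by
      simp only [faceDof, evalField_add, dotProduct_add]
      exact faceIntegral_add i (continuous_faceIntegrand v n q) (continuous_faceIntegrand v n r))
    (fun c v q => by
      simp only [faceDof, evalField_smul, dotProduct_smul, smul_eq_mul]
      exact faceIntegral_const_mul i c _)

theorem edgeDof_eq_zero_of_restrict {e : Edge} (t : Vec) (v : PolyField) {q : Poly}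
    (hq : restrictPoly (edge p e) q = 0) : edgeDof p e t v q = 0 := by
  rw [edgeDof, edgeIntegral_congr (g := fun _ => 0 * 0)]
  · rw [edgeIntegral_const_mul, zero_mul]
  · intro x hx
    have : eval x q = 0 := congrFun hq ⟨x, hx⟩
    simp [this]

theorem faceDof_eq_zero_of_restrict {i : Fin 4} (n : Vec) (v : PolyField) {q : PolyField}
    (hq : restrictField (face p i) q = 0) : faceDof p i n v q = 0 := by
  rw [faceDof, faceIntegral_congr (g := fun _ => 0 * 0)]
  · rw [faceIntegral_const_mul, zero_mul]
  · intro x hx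
    have : evalField q x = 0 := congrFun hq ⟨x, hx⟩
    simp [this]

/-! ### Dimensions of the test spaces -/

theorem eval_bary_edge (hp : AffineIndependent ℝ p) (i j l : Fin 4) (s : ℝ) :
    eval (p i + s • (p j - p i)) (bary p l) =
      (1 - s) * (Pi.single i 1 : Fin 4 → ℝ) l + s * (Pi.single j 1 : Fin 4 → ℝ) l := by
  rw [← eval_bary_vertex hp, ← eval_bary_vertex hp, eval_bary, eval_bary, eval_bary]
  simp only [dotProduct_sub, dotProduct_add, dotProduct_smul, smul_eq_mul]
  ring

/-- A polynomial on an edge is a univariate polynomial in the barycentric coordinate of one of the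
endpoints. -/
theorem finrank_edgeTest_le (hp : AffineIndependent ℝ p) (k : ℕ) (e : Edge) :
    FiniteDimensional ℝ (EdgeTest p k e) ∧ Module.finrank ℝ (EdgeTest p k e) ≤ k + 1 := by
  let ψ : Poly →ₗ[ℝ] Polynomial ℝ := (aeval fun l : Fin 3 =>
    (Polynomial.C (p e.1.1 l) + Polynomial.C ((p e.1.2 - p e.1.1) l) * Polynomial.X :
      Polynomial ℝ)).toLinearMap
  let ρ : Polynomial ℝ →ₗ[ℝ] (edge p e → ℝ) :=
    LinearMap.pi fun x => (Polynomial.aeval (eval x.1 (bary p e.1.2))).toLinearMap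
  have hρψ : restrictPoly (edge p e) = ρ ∘ₗ ψ := by
    refine LinearMap.ext fun q => funext fun ⟨x, hx⟩ => ?_
    have hx' : x = p e.1.1 + eval x (bary p e.1.2) • (p e.1.2 - p e.1.1) := by
      rw [edge, segment_eq_image'] at hx
      obtain ⟨s, -, rfl⟩ := hx
      rw [eval_bary_edge hp, Pi.single_eq_of_ne e.2.ne', Pi.single_eq_same]
      simp
    change eval x q = Polynomial.aeval (eval x (bary p e.1.2)) (aeval _ q)
    rw [← AlgHom.comp_apply, comp_aeval, ← coe_aeval_eq_eval]
    change aeval x q = _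
    congr 2
    ext l
    simp only [map_add, map_mul, Polynomial.aeval_C, Polynomial.aeval_X]
    conv_lhs => rw [hx']
    simp [mul_comm]
  have hle : EdgeTest p k e ≤ (Polynomial.degreeLT ℝ (k + 1)).map ρ := by
    rw [EdgeTest, hρψ, Submodule.map_comp]
    refine Submodule.map_mono ?_
    rintro _ ⟨q, hq, rfl⟩
    have hdeg : q.totalDegree ≤ k := by
      refine Finset.sup_le fun s hs => ?_
      have : (s.degree : ℤ) ≤ k := hq hs
      exact_mod_cast this
    have hnat : (ψ q).natDegree ≤ k * 1 :=
      aeval_natDegree_le q hdeg _ fun l => by compute_degree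
    rw [Polynomial.mem_degreeLT]
    exact Polynomial.degree_le_natDegree.trans_lt (by exact_mod_cast (by omega))
  have : FiniteDimensional ℝ (Polynomial.degreeLT ℝ (k + 1)) :=
    (Polynomial.degreeLTEquiv ℝ (k + 1)).symm.finiteDimensional
  refine ⟨inferInstance,
    (Submodule.finrank_mono hle).trans ((Submodule.finrank_map_le _ _).trans ?_)⟩
  rw [(Polynomial.degreeLTEquiv ℝ (k + 1)).finrank_eq]
  simp

/-- The constant fields as a linear map. -/
def constFieldₗ : Vec →ₗ[ℝ] PolyField where
  toFun := constField
  map_add' a b := by ext1 i; simp [constField]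
  map_smul' c a := by ext1 i; simp [constField, smul_eq_C_mul]

theorem tangConst_eq (n : Vec) :
    tangConst n = (LinearMap.ker (dotProductBilin ℝ ℝ n)).map constFieldₗ := by
  ext q
  constructor
  · rintro ⟨a, ha, rfl⟩
    exact ⟨a, by simpa [dotProduct_comm] using ha, rfl⟩
  · rintro ⟨a, ha, rfl⟩
    exact ⟨a, by simpa [dotProduct_comm] using ha, rfl⟩

instance (n : Vec) : FiniteDimensional ℝ (tangConst n) := by
  rw [tangConst_eq]; infer_instance

theorem finrank_tangConst_le {n : Vec} (hn : n ≠ 0) : Module.finrank ℝ (tangConst n) ≤ 2 := by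
  rw [tangConst_eq]
  refine (Submodule.finrank_map_le _ _).trans ?_
  have h : LinearMap.ker (dotProductBilin ℝ ℝ n) < ⊤ := by
    rw [lt_top_iff_ne_top]
    intro h
    have : n ∈ LinearMap.ker (dotProductBilin ℝ ℝ n) := h ▸ Submodule.mem_top
    exact hn (dotProduct_self_eq_zero.1 this)
  exact Nat.le_of_lt_succ ((Submodule.finrank_lt h.ne).trans_eq (Module.finrank_fin_fun ℝ))

instance (m : ℤ) (n : Vec) : FiniteDimensional ℝ (rmField m n) := by
  unfold rmField; infer_instance

instance (n : Vec) : FiniteDimensional ℝ (rtField n) := by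
  unfold rtField; infer_instance

/-- A bound for both kinds of test spaces on a face; that it is attained is not needed. -/
theorem finrank_test_le {n : Vec} (hn : n ≠ 0) (S : Set Vec) (w : PolyField) (m : ℤ) :
    Module.finrank ℝ ((tangConst n ⊔ (polyDeg m).map (mulField w)).map (restrictField S)) ≤
      2 + Module.finrank ℝ (polyDeg m) :=
  (Submodule.finrank_map_le _ _).trans <|
    (Submodule.finrank_add_le_finrank_add_finrank _ _).trans <|
      add_le_add (finrank_tangConst_le hn) (Submodule.finrank_map_le _ _)

theorem finrank_polyDeg_neg_one : Module.finrank ℝ (polyDeg (-1)) = 0 := by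
  have : polyDeg (-1) = ⊥ := by
    rw [polyDeg, restrictSupport_eq_span, Submodule.span_eq_bot]
    rintro _ ⟨s, hs, rfl⟩
    simp only [Set.mem_ofPred_eq] at hs
    omega
  rw [this, finrank_bot]

/-! ### Reduction of unisolvence to uniqueness -/

/-- A bilinear form that depends on its second argument only through the image under a surjection
`f` descends to that image. -/
theorem exists_dual_map {V M N : Type*} [AddCommGroup V] [Module ℝ V] [AddCommGroup M] [Module ℝ M]
    [AddCommGroup N] [Module ℝ N] {f : M →ₗ[ℝ] N} (hf : Function.Surjective f)
    (B : V →ₗ[ℝ] M →ₗ[ℝ] ℝ) (hB : ∀ v m, f m = 0 → B v m = 0) :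
    ∃ Φ : V →ₗ[ℝ] Module.Dual ℝ N, ∀ v m, Φ v (f m) = B v m := by
  obtain ⟨g, hg⟩ := f.exists_rightInverse_of_surjective (LinearMap.range_eq_top.2 hf)
  refine ⟨B.compl₂ g, fun v m => ?_⟩
  rw [LinearMap.compl₂_apply, ← sub_eq_zero, ← map_sub]
  refine hB v _ ?_
  rw [map_sub, sub_eq_zero]
  exact LinearMap.congr_fun hg (f m)

/-- Three families of bilinear moments against finite-dimensional test spaces `N`, each a quotient
of a space `M` on which the moments are computed, attain all values exactly once as soon as they
separate points and there are not more of them than the dimension of the space. -/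
theorem existsUnique_of_moments {V ι κ : Type*} [AddCommGroup V] [Module ℝ V]
    [FiniteDimensional ℝ V] [Fintype ι] [Fintype κ]
    {M N : ι → Type*} [∀ i, AddCommGroup (M i)] [∀ i, Module ℝ (M i)]
    [∀ i, AddCommGroup (N i)] [∀ i, Module ℝ (N i)] [∀ i, FiniteDimensional ℝ (N i)]
    {f : ∀ i, M i →ₗ[ℝ] N i} (hf : ∀ i, Function.Surjective (f i))
    {B : ∀ i, V →ₗ[ℝ] M i →ₗ[ℝ] ℝ} (hB : ∀ i v m, f i m = 0 → B i v m = 0)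
    {M' N' : κ → Type*} [∀ i, AddCommGroup (M' i)] [∀ i, Module ℝ (M' i)]
    [∀ i, AddCommGroup (N' i)] [∀ i, Module ℝ (N' i)] [∀ i, FiniteDimensional ℝ (N' i)]
    {f' : ∀ i, M' i →ₗ[ℝ] N' i} (hf' : ∀ i, Function.Surjective (f' i))
    {B' : ∀ i, V →ₗ[ℝ] M' i →ₗ[ℝ] ℝ} (hB' : ∀ i v m, f' i m = 0 → B' i v m = 0)
    {M'' N'' : κ → Type*} [∀ i, AddCommGroup (M'' i)] [∀ i, Module ℝ (M'' i)]
    [∀ i, AddCommGroup (N'' i)] [∀ i, Module ℝ (N'' i)] [∀ i, FiniteDimensional ℝ (N'' i)]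
    {f'' : ∀ i, M'' i →ₗ[ℝ] N'' i} (hf'' : ∀ i, Function.Surjective (f'' i))
    {B'' : ∀ i, V →ₗ[ℝ] M'' i →ₗ[ℝ] ℝ} (hB'' : ∀ i v m, f'' i m = 0 → B'' i v m = 0)
    (hdim : ∑ i, Module.finrank ℝ (N i) + (∑ i, Module.finrank ℝ (N' i) +
      ∑ i, Module.finrank ℝ (N'' i)) ≤ Module.finrank ℝ V)
    (hinj : ∀ v, (∀ i m, B i v m = 0) → (∀ i m, B' i v m = 0) → (∀ i m, B'' i v m = 0) → v = 0)
    (α : ∀ i, Module.Dual ℝ (N i)) (β : ∀ i, Module.Dual ℝ (N' i))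
    (γ : ∀ i, Module.Dual ℝ (N'' i)) :
    ∃! v, (∀ i m, B i v m = α i (f i m)) ∧ (∀ i m, B' i v m = β i (f' i m)) ∧
      (∀ i m, B'' i v m = γ i (f'' i m)) := by
  choose Φ hΦ using fun i => exists_dual_map (hf i) (B i) (hB i)
  choose Φ' hΦ' using fun i => exists_dual_map (hf' i) (B' i) (hB' i)
  choose Φ'' hΦ'' using fun i => exists_dual_map (hf'' i) (B'' i) (hB'' i)
  let Ψ : V →ₗ[ℝ] (∀ i, Module.Dual ℝ (N i)) × (∀ i, Module.Dual ℝ (N' i)) ×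
      (∀ i, Module.Dual ℝ (N'' i)) :=
    (LinearMap.pi Φ).prod ((LinearMap.pi Φ').prod (LinearMap.pi Φ''))
  have hΨ : Function.Injective Ψ := by
    rw [injective_iff_map_eq_zero]
    intro v hv
    obtain ⟨h1, h23⟩ := Prod.ext_iff.1 hv
    obtain ⟨h2, h3⟩ := Prod.ext_iff.1 h23
    refine hinj v (fun i m => ?_) (fun i m => ?_) (fun i m => ?_)
    · exact (hΦ i v m).symm.trans (LinearMap.congr_fun (congrFun h1 i) _)
    · exact (hΦ' i v m).symm.trans (LinearMap.congr_fun (congrFun h2 i) _)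
    · exact (hΦ'' i v m).symm.trans (LinearMap.congr_fun (congrFun h3 i) _)
  have hle : Module.finrank ℝ ((∀ i, Module.Dual ℝ (N i)) × (∀ i, Module.Dual ℝ (N' i)) ×
      (∀ i, Module.Dual ℝ (N'' i))) ≤ Module.finrank ℝ V := by
    simpa only [Module.finrank_prod, Module.finrank_pi_fintype, Subspace.dual_finrank_eq]
  refine existsUnique_of_exists_of_unique ?_ ?_
  · obtain ⟨v, hv⟩ := (LinearMap.injective_iff_surjective_of_finrank_eq_finrank
      (le_antisymm (LinearMap.finrank_le_finrank_of_injective hΨ) hle)).1 hΨ (α, β, γ)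
    obtain ⟨h1, h23⟩ := Prod.ext_iff.1 hv
    obtain ⟨h2, h3⟩ := Prod.ext_iff.1 h23
    refine ⟨v, fun i m => ?_, fun i m => ?_, fun i m => ?_⟩
    · exact (hΦ i v m).symm.trans (LinearMap.congr_fun (congrFun h1 i) _)
    · exact (hΦ' i v m).symm.trans (LinearMap.congr_fun (congrFun h2 i) _)
    · exact (hΦ'' i v m).symm.trans (LinearMap.congr_fun (congrFun h3 i) _)
  · rintro v w ⟨hv1, hv2, hv3⟩ ⟨hw1, hw2, hw3⟩
    rw [← sub_eq_zero]
    refine hinj _ (fun i m => ?_) (fun i m => ?_) (fun i m => ?_) <;>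
      rw [map_sub, LinearMap.sub_apply, sub_eq_zero]
    · rw [hv1, hw1]
    · rw [hv2, hw2]
    · rw [hv3, hw3]

theorem unisolvent_of_injective (hp : AffineIndependent ℝ p) {k : ℕ} {t : Edge → Vec}
    {n : Fin 4 → Vec} (hn : IsUnitNormals p n) {W : Submodule ℝ PolyField}
    [FiniteDimensional ℝ W]
    (hdim : 6 * (k + 1) + 4 * (2 + Module.finrank ℝ (polyDeg ((k : ℤ) - 2))) + 12 ≤
      Module.finrank ℝ W)
    (hinj : ∀ v ∈ W, (∀ e, ∀ q ∈ polyDeg k, edgeDof p e (t e) v q = 0) →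
      (∀ i, ∀ q ∈ rmField ((k : ℤ) - 2) (n i), faceDof p i (n i) v q = 0) →
      (∀ i, ∀ q ∈ rtField (n i), faceDof p i (n i) (curl v) q = 0) → v = 0) :
    Unisolvent p k t n W := by
  intro α β γ
  have hn0 (i : Fin 4) : n i ≠ 0 := fun h => by simpa [h] using (hn i).1
  have hE0 := fun e => (finrank_edgeTest_le hp k e).1
  have hR0 (i : Fin 4) : FiniteDimensional ℝ (RMTest p ((k : ℤ) - 2) i (n i)) :=
    inferInstance
  have hT0 (i : Fin 4) : FiniteDimensional ℝ (RTTest p i (n i)) :=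
    inferInstance
  have hE : ∑ e : Edge, Module.finrank ℝ (EdgeTest p k e) ≤ 6 * (k + 1) := by
    refine (Finset.sum_le_card_nsmul _ _ _ fun e _ => (finrank_edgeTest_le hp k e).2).trans ?_
    rw [Finset.card_univ, show Fintype.card Edge = 6 by decide, smul_eq_mul]
  have hR : ∑ i, Module.finrank ℝ (RMTest p ((k : ℤ) - 2) i (n i)) ≤
      4 * (2 + Module.finrank ℝ (polyDeg ((k : ℤ) - 2))) :=
    Finset.sum_le_card_nsmul _ _ _ fun i _ => finrank_test_le (hn0 i) _ _ _
  have hT : ∑ i, Module.finrank ℝ (RTTest p i (n i)) ≤ 12 :=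
    Finset.sum_le_card_nsmul _ _ 3 fun i _ => (finrank_test_le (hn0 i) _ _ _).trans_eq
      (by rw [← Nat.cast_zero, finrank_polyDeg]; rfl)
  obtain ⟨v, ⟨h1, h2, h3⟩, huniq⟩ := existsUnique_of_moments
    (fun e => (restrictPoly (edge p e)).submoduleMap_surjective (polyDeg k))
    (B := fun e => (edgeDofBilin p e (t e)).domRestrict₁₂ W (polyDeg k))
    (fun e v q hq => edgeDof_eq_zero_of_restrict (t e) v.1 (congrArg Subtype.val hq))
    (fun i => (restrictField (face p i)).submoduleMap_surjective (rmField ((k : ℤ) - 2) (n i)))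
    (B' := fun i => (faceDofBilin p i (n i)).domRestrict₁₂ W (rmField ((k : ℤ) - 2) (n i)))
    (fun i v q hq => faceDof_eq_zero_of_restrict (n i) v.1 (congrArg Subtype.val hq))
    (fun i => (restrictField (face p i)).submoduleMap_surjective (rtField (n i)))
    (B'' := fun i => ((faceDofBilin p i (n i)).comp curl).domRestrict₁₂ W (rtField (n i)))
    (fun i v q hq => faceDof_eq_zero_of_restrict (n i) (curl v.1) (congrArg Subtype.val hq))
    ((add_le_add hE (add_le_add hR hT)).trans (by omega))
    (fun v h1 h2 h3 => Subtype.ext (hinj v.1 v.2 (fun e q hq => h1 e ⟨q, hq⟩)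
      (fun i q hq => h2 i ⟨q, hq⟩) (fun i q hq => h3 i ⟨q, hq⟩))) α β γ
  refine ⟨v.1, ⟨v.2, h1, h2, h3⟩, fun w hw => ?_⟩
  exact congrArg Subtype.val (huniq ⟨w, hw.1⟩ hw.2)

/-! ### Moments of monomials in barycentric coordinates -/

/-- Euler's beta integral for natural exponents, on an interval of arbitrary length. -/
theorem integral_sub_pow_mul_pow (L : ℝ) (a c : ℕ) :
    ∫ r in (0 : ℝ)..L, (L - r) ^ a * r ^ c =
      L ^ (a + c + 1) * (a.factorial * c.factorial / (a + c + 1).factorial) := by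
  induction a generalizing c with
  | zero =>
    simp only [pow_zero, one_mul, integral_pow, Nat.factorial_zero, Nat.cast_one, zero_add,
      Nat.factorial_succ c]
    have : (c.factorial : ℝ) ≠ 0 := by positivity
    push_cast
    field_simp
    simp
  | succ a ih =>
    -- Integration by parts: the derivative of `(L - r) ^ (a + 1) * r ^ (c + 1)` has integral zero.
    have hd (r : ℝ) : HasDerivAt (fun r => (L - r) ^ (a + 1) * r ^ (c + 1))
        (((c : ℝ) + 1) * ((L - r) ^ (a + 1) * r ^ c) -
          ((a : ℝ) + 1) * ((L - r) ^ a * r ^ (c + 1))) r := by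
      refine ((((hasDerivAt_id' r).const_sub L).fun_pow (a + 1)).fun_mul
        ((hasDerivAt_id' r).fun_pow (c + 1))).congr_deriv ?_
      push_cast
      ring
    have h1 := intervalIntegral.integral_eq_sub_of_hasDerivAt (a := 0) (b := L)
      (fun r _ => hd r) (Continuous.intervalIntegrable (by fun_prop) _ _)
    rw [intervalIntegral.integral_sub (Continuous.intervalIntegrable (by fun_prop) _ _)
      (Continuous.intervalIntegrable (by fun_prop) _ _), intervalIntegral.integral_const_mul,
      intervalIntegral.integral_const_mul, ih (c + 1)] at h1
    have h2 : ((c : ℝ) + 1) * ∫ r in (0 : ℝ)..L, (L - r) ^ (a + 1) * r ^ c =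
        ((a : ℝ) + 1) * (L ^ (a + (c + 1) + 1) *
          (a.factorial * (c + 1).factorial / (a + (c + 1) + 1).factorial)) := by
      simp at h1
      linarith
    have h3 : ((c : ℝ) + 1) ≠ 0 := by positivity
    refine mul_left_cancel₀ h3 (h2.trans ?_)
    rw [Nat.factorial_succ a, Nat.factorial_succ c, show a + (c + 1) + 1 = a + 1 + c + 1 by ring]
    push_cast
    ring

/-- Dirichlet's formula for the moments of the monomials in the barycentric coordinates of the
reference triangle. -/
theorem triangleIntegral_monomial (a b c : ℕ) :
    triangleIntegral (fun s r => (1 - s - r) ^ a * s ^ b * r ^ c) =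
      a.factorial * b.factorial * c.factorial / (a + b + c + 2).factorial := by
  have h (s : ℝ) : ∫ r in (0 : ℝ)..(1 - s), (1 - s - r) ^ a * s ^ b * r ^ c =
      (a.factorial * c.factorial / (a + c + 1).factorial) * ((1 - s) ^ (a + c + 1) * s ^ b) := by
    simp only [mul_right_comm _ (s ^ b), intervalIntegral.integral_mul_const,
      integral_sub_pow_mul_pow]
    ring
  simp only [triangleIntegral, h, intervalIntegral.integral_const_mul, integral_sub_pow_mul_pow]
  rw [show a + c + 1 + b + 1 = a + b + c + 2 by ring]
  have : ((a + c + 1).factorial : ℝ) ≠ 0 := by positivity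
  field_simp
  simp

theorem triangleIntegral_combination {f g h : ℝ → ℝ → ℝ} (hf : Continuous (Function.uncurry f))
    (hg : Continuous (Function.uncurry g)) (hh : Continuous (Function.uncurry h)) (A B C : ℝ) :
    triangleIntegral (fun s r => A * f s r + B * g s r + C * h s r) =
      A * triangleIntegral f + B * triangleIntegral g + C * triangleIntegral h := by
  have hc {f : ℝ → ℝ → ℝ} (hf : Continuous (Function.uncurry f)) (A : ℝ) :
      Continuous (Function.uncurry fun s r => A * f s r) := continuous_const.mul hf
  rw [triangleIntegral_add (G := fun s r => A * f s r + B * g s r)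
    ((hc hf A).add (hc hg B)) (hc hh C), triangleIntegral_add (hc hf A) (hc hg B),
    triangleIntegral_const_mul, triangleIntegral_const_mul, triangleIntegral_const_mul]

theorem triangleIntegral_combination_monomial (A B C : ℝ) (a b c a' b' c' a'' b'' c'' : ℕ) :
    triangleIntegral (fun s r => A * ((1 - s - r) ^ a * s ^ b * r ^ c) +
      B * ((1 - s - r) ^ a' * s ^ b' * r ^ c') + C * ((1 - s - r) ^ a'' * s ^ b'' * r ^ c'')) =
      A * (a.factorial * b.factorial * c.factorial / (a + b + c + 2).factorial) +
      B * (a'.factorial * b'.factorial * c'.factorial / (a' + b' + c' + 2).factorial) +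
      C * (a''.factorial * b''.factorial * c''.factorial / (a'' + b'' + c'' + 2).factorial) := by
  have h (a b c : ℕ) : Continuous (Function.uncurry fun s r : ℝ =>
      (1 - s - r) ^ a * s ^ b * r ^ c) := by
    unfold Function.uncurry
    fun_prop
  rw [triangleIntegral_combination (h _ _ _) (h _ _ _) (h _ _ _), triangleIntegral_monomial,
    triangleIntegral_monomial, triangleIntegral_monomial]

/-- The Bernstein form of a quadratic polynomial is determined by its first three moments, and by
its first two when its degree is at most one. -/
theorem quadratic_eq_zero_of_moments {k : ℕ} (hk : k = 1 ∨ k = 2) {A B C : ℝ}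
    (hred : k = 1 → A - 2 * B + C = 0)
    (h : ∀ m ≤ k, ∫ s in (0 : ℝ)..1,
      (A * (1 - s) ^ 2 + 2 * B * (s * (1 - s)) + C * s ^ 2) * s ^ m = 0) :
    A = 0 ∧ B = 0 ∧ C = 0 := by
  have key (m : ℕ) : ∫ s in (0 : ℝ)..1,
      (A * (1 - s) ^ 2 + 2 * B * (s * (1 - s)) + C * s ^ 2) * s ^ m =
      A * (2 * m.factorial / (m + 3).factorial) + 2 * B * ((m + 1).factorial / (m + 3).factorial)
        + C * ((m + 2).factorial / (m + 3).factorial) := by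
    have hi (a c : ℕ) (D : ℝ) : IntervalIntegrable (fun s : ℝ => D * ((1 - s) ^ a * s ^ c))
        MeasureTheory.volume 0 1 := Continuous.intervalIntegrable (by fun_prop) _ _
    have e (s : ℝ) : (A * (1 - s) ^ 2 + 2 * B * (s * (1 - s)) + C * s ^ 2) * s ^ m =
        A * ((1 - s) ^ 2 * s ^ m) + 2 * B * ((1 - s) ^ 1 * s ^ (m + 1)) +
          C * ((1 - s) ^ 0 * s ^ (m + 2)) := by ring
    simp only [e]
    rw [intervalIntegral.integral_add ((hi _ _ _).add (hi _ _ _)) (hi _ _ _),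
      intervalIntegral.integral_add (hi _ _ _) (hi _ _ _), intervalIntegral.integral_const_mul,
      intervalIntegral.integral_const_mul, intervalIntegral.integral_const_mul,
      integral_sub_pow_mul_pow, integral_sub_pow_mul_pow, integral_sub_pow_mul_pow]
    rw [show 2 + m + 1 = m + 3 by ring, show 1 + (m + 1) + 1 = m + 3 by ring,
      show 0 + (m + 2) + 1 = m + 3 by ring]
    simp [Nat.factorial]
  simp only [key] at h
  have h0 := h 0 (by omega)
  have h1 := h 1 (by omega)
  norm_num [Nat.factorial] at h0 h1
  rcases hk with rfl | rfl
  · have h2 := hred rfl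
    refine ⟨?_, ?_, ?_⟩ <;> linarith
  · have h2 := h 2 le_rfl
    norm_num [Nat.factorial] at h2
    refine ⟨?_, ?_, ?_⟩ <;> linarith

/-! ### Quadratic tangential fields on a triangle -/

/-- A quadratic field on a triangle whose Bernstein coefficients at the vertices vanish and whose
coefficient on each side is orthogonal to that side, written through the three numbers that remain:
the products of the side coefficients with an edge to the opposite vertex. They vanish if the
moments against `x - P j` do, for in terms of these the system has the matrix with `-4` on the
diagonal and `1` off it. If the trace of the field is of the reduced type, so that the three
numbers sum to zero, the constant moments suffice, as they make them equal. -/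
theorem triangle_coeff_eq_zero {k : ℕ} (hk : k = 1 ∨ k = 2) (P : Fin 3 → Vec)
    (V : Fin 3 → Fin 3 → Vec) (hsymm : ∀ m l, V m l = V l m) (hdiag : ∀ m, V m m = 0)
    (hedge : ∀ m l, V m l ⬝ᵥ (P l - P m) = 0)
    (hred : k = 1 → ∀ d : Fin 3 → ℝ, ∑ m, d m = 0 →
      (∑ m, ∑ l, (d m * d l) • V m l) ⬝ᵥ (∑ h, d h • P h) = 0)
    (hconst : k = 1 → ∀ j, triangleIntegral (fun s r =>
      (∑ m, ∑ l, (![1 - s - r, s, r] m * ![1 - s - r, s, r] l) • V m l) ⬝ᵥ (P j - P 0)) = 0)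
    (hpos : k = 2 → ∀ j, triangleIntegral (fun s r =>
      (∑ m, ∑ l, (![1 - s - r, s, r] m * ![1 - s - r, s, r] l) • V m l) ⬝ᵥ
        (∑ h, ![1 - s - r, s, r] h • P h - P j)) = 0)
    (m l h : Fin 3) : V m l ⬝ᵥ (P h - P m) = 0 := by
  have hsum (d : Fin 3 → ℝ) (y : Vec) : (∑ m, ∑ l, (d m * d l) • V m l) ⬝ᵥ y =
      2 * (d 0 * d 1 * (V 0 1 ⬝ᵥ y) + d 1 * d 2 * (V 1 2 ⬝ᵥ y) + d 0 * d 2 * (V 0 2 ⬝ᵥ y)) := by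
    simp only [Fin.sum_univ_three, hdiag, smul_zero, hsymm 1 0, hsymm 2 0, hsymm 2 1,
      add_dotProduct, smul_dotProduct, smul_eq_mul, zero_dotProduct]
    ring
  have e01 := hedge 0 1
  have e12 := hedge 1 2
  have e02 := hedge 0 2
  simp only [hsum] at hred hconst hpos
  clear hsum
  simp only [Fin.sum_univ_three, dotProduct_sub, dotProduct_add, dotProduct_smul,
    smul_eq_mul, Matrix.cons_val] at hred hconst hpos e01 e12 e02 ⊢
  have key : V 0 1 ⬝ᵥ P 2 - V 0 1 ⬝ᵥ P 0 = 0 ∧ V 1 2 ⬝ᵥ P 0 - V 1 2 ⬝ᵥ P 1 = 0 ∧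
      V 0 2 ⬝ᵥ P 1 - V 0 2 ⬝ᵥ P 0 = 0 := by
    set X := V 0 1 ⬝ᵥ P 2 - V 0 1 ⬝ᵥ P 0 with hX
    set Y := V 1 2 ⬝ᵥ P 0 - V 1 2 ⬝ᵥ P 1 with hY
    set Z := V 0 2 ⬝ᵥ P 1 - V 0 2 ⬝ᵥ P 0 with hZ
    rcases hk with rfl | rfl
    · have h1 := hconst rfl 1
      have h2 := hconst rfl 2
      -- At `(1, 1, -2)` all three products `d m * d l * d h` are equal and nonzero.
      have h3 := hred rfl ![1, 1, -2] (by simp; norm_num)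
      have i1 : triangleIntegral (fun s r => (2 * Z) * ((1 - s - r) ^ 1 * s ^ 0 * r ^ 1) +
          (-2 * Y) * ((1 - s - r) ^ 0 * s ^ 1 * r ^ 1) +
          0 * ((1 - s - r) ^ 0 * s ^ 0 * r ^ 0)) = 0 := by
        refine (congrArg triangleIntegral (funext₂ fun s r => ?_)).trans h1
        linear_combination (-2 * (1 - s - r) * s) * e01
      have i2 : triangleIntegral (fun s r => (2 * X) * ((1 - s - r) ^ 1 * s ^ 1 * r ^ 0) +
          (-2 * Y) * ((1 - s - r) ^ 0 * s ^ 1 * r ^ 1) +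
          0 * ((1 - s - r) ^ 0 * s ^ 0 * r ^ 0)) = 0 := by
        refine (congrArg triangleIntegral (funext₂ fun s r => ?_)).trans h2
        linear_combination (-2 * (1 - s - r) * r) * e02 - 2 * s * r * e12
      rw [triangleIntegral_combination_monomial] at i1 i2
      simp only [Matrix.cons_val] at h3
      norm_num [Nat.factorial] at i1 i2
      refine ⟨?_, ?_, ?_⟩ <;> linarith
    · have h0 := hpos rfl 0
      have h1 := hpos rfl 1
      have h2 := hpos rfl 2
      have i0 : triangleIntegral (fun s r => (-2 * Y) * ((1 - s - r) ^ 0 * s ^ 2 * r ^ 1) +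
          (-2 * Y) * ((1 - s - r) ^ 0 * s ^ 1 * r ^ 2) +
          (2 * (X + Z)) * ((1 - s - r) ^ 1 * s ^ 1 * r ^ 1)) = 0 := by
        refine (congrArg triangleIntegral (funext₂ fun s r => ?_)).trans h0
        linear_combination (-2 * (1 - s - r) * s ^ 2) * e01 - 2 * s * r ^ 2 * e12 -
          2 * (1 - s - r) * r ^ 2 * e02
      have i1 : triangleIntegral (fun s r => (-2 * Z) * ((1 - s - r) ^ 2 * s ^ 0 * r ^ 1) +
          (-2 * Z) * ((1 - s - r) ^ 1 * s ^ 0 * r ^ 2) +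
          (2 * (X + Y)) * ((1 - s - r) ^ 1 * s ^ 1 * r ^ 1)) = 0 := by
        refine (congrArg triangleIntegral (funext₂ fun s r => ?_)).trans h1
        linear_combination (2 * (1 - s - r) * s * (1 - s)) * e01 - 2 * s * r ^ 2 * e12 -
          2 * (1 - s - r) * r ^ 2 * e02
      have i2 : triangleIntegral (fun s r => (-2 * X) * ((1 - s - r) ^ 2 * s ^ 1 * r ^ 0) +
          (-2 * X) * ((1 - s - r) ^ 1 * s ^ 2 * r ^ 0) +
          (2 * (Y + Z)) * ((1 - s - r) ^ 1 * s ^ 1 * r ^ 1)) = 0 := by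
        refine (congrArg triangleIntegral (funext₂ fun s r => ?_)).trans h2
        linear_combination (-2 * (1 - s - r) * s ^ 2) * e01 + 2 * s * r * (1 - r) * e12 +
          2 * (1 - s - r) * r * (1 - r) * e02
      rw [triangleIntegral_combination_monomial] at i0 i1 i2
      norm_num [Nat.factorial] at i0 i1 i2
      refine ⟨?_, ?_, ?_⟩ <;> linarith
  obtain ⟨h1, h2, h3⟩ := key
  fin_cases m <;> fin_cases l <;> fin_cases h <;>
    simp [hdiag, hsymm 1 0, hsymm 2 0, hsymm 2 1] <;> linarith

/-! ### Bernstein coefficients of quadratic fields -/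

theorem exists_bernstein_scalar {f : Poly} (hf : f ∈ polyDeg 2) (p : Fin 4 → Vec) :
    ∃ B : Fin 4 → Fin 4 → ℝ, (∀ i j, B i j = B j i) ∧ ∀ μ : Fin 4 → ℝ, ∑ j, μ j = 1 →
      eval (baryPoint p μ) f = ∑ i, ∑ j, μ i * μ j * B i j := by
  have hf' := polyDeg_two_le hf
  clear hf
  induction hf' using Submodule.mul_induction_on' with
  | mem_mul_mem g hg h hh =>
    refine ⟨fun i j => (eval (p i) g * eval (p j) h + eval (p j) g * eval (p i) h) / 2,
      fun i j => by ring, fun μ hμ => ?_⟩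
    rw [map_mul, eval_baryPoint hg hμ, eval_baryPoint hh hμ]
    simp only [Fin.sum_univ_four]
    ring
  | add f _ g _ hf hg =>
    obtain ⟨A, hA, hf⟩ := hf
    obtain ⟨B, hB, hg⟩ := hg
    refine ⟨fun i j => A i j + B i j, fun i j => congrArg₂ (· + ·) (hA i j) (hB i j), fun μ hμ => ?_⟩
    simp only [map_add, hf μ hμ, hg μ hμ, mul_add, Finset.sum_add_distrib]

theorem exists_bernstein_of_quadratic {v : PolyField} (hv : v ∈ polyFieldDeg 2)
    (p : Fin 4 → Vec) :
    ∃ V : Fin 4 → Fin 4 → Vec, (∀ i j, V i j = V j i) ∧ ∀ μ : Fin 4 → ℝ, ∑ j, μ j = 1 →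
      evalField v (baryPoint p μ) = ∑ i, ∑ j, (μ i * μ j) • V i j := by
  choose B hB hv using fun l => exists_bernstein_scalar (mem_polyFieldDeg.1 hv l) p
  refine ⟨fun i j l => B l i j, fun i j => funext fun l => hB l i j, fun μ hμ => ?_⟩
  ext l
  change eval (baryPoint p μ) (v l) = _
  rw [hv l μ hμ]
  simp [Finset.sum_apply]

/-- The Bernstein coefficients of `∇q + x × w` over the tetrahedron. For `k = 1` the quadratic part
of this field comes from `x × w` alone, hence is orthogonal to its argument. -/
theorem exists_bernstein {k : ℕ} (hk : k = 1 ∨ k = 2) {q : Poly} (hq : q ∈ polyDeg (k + 1))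
    {w : PolyField} (hw : w ∈ polyFieldDeg 1) (p : Fin 4 → Vec) :
    ∃ V : Fin 4 → Fin 4 → Vec, (∀ i j, V i j = V j i) ∧ (∀ μ : Fin 4 → ℝ, ∑ j, μ j = 1 →
      evalField (grad q + posField ⨯₃ w) (baryPoint p μ) = ∑ i, ∑ j, (μ i * μ j) • V i j) ∧
      (k = 1 → ∀ d : Fin 4 → ℝ, ∑ j, d j = 0 →
        (∑ i, ∑ j, (d i * d j) • V i j) ⬝ᵥ baryPoint p d = 0) := by
  have hg := grad_mem_polyFieldDeg hq
  rcases hk with rfl | rfl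
  · rw [Nat.cast_one] at hg
    have hcross (d : Fin 4 → ℝ) : ∑ i, ∑ j, (d i * d j) • ((1 / 2 : ℝ) •
        (p i ⨯₃ evalField w (p j) + p j ⨯₃ evalField w (p i))) =
        baryPoint p d ⨯₃ ∑ j, d j • evalField w (p j) := by
      have h1 : baryPoint p d ⨯₃ ∑ j, d j • evalField w (p j) =
          ∑ i, ∑ j, (d i * d j) • (p i ⨯₃ evalField w (p j)) := by
        simp only [baryPoint, map_sum, map_smul, LinearMap.sum_apply, LinearMap.smul_apply,
          Finset.smul_sum, smul_smul]
        rw [Finset.sum_comm]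
        simp only [mul_comm]
      have h2 : ∑ i, ∑ j, (d i * d j) • (p j ⨯₃ evalField w (p i)) =
          ∑ i, ∑ j, (d i * d j) • (p i ⨯₃ evalField w (p j)) := by
        rw [Finset.sum_comm]
        simp only [mul_comm]
      simp only [smul_comm _ (1 / 2 : ℝ), smul_add, Finset.sum_add_distrib, ← Finset.smul_sum, h2,
        h1]
      module
    have hgrad (d : Fin 4 → ℝ) : ∑ i, ∑ j, (d i * d j) • ((1 / 2 : ℝ) •
        (evalField (grad q) (p i) + evalField (grad q) (p j))) =
        (∑ j, d j) • ∑ j, d j • evalField (grad q) (p j) := by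
      simp only [Fin.sum_univ_four]
      module
    refine ⟨fun i j => (1 / 2 : ℝ) • (evalField (grad q) (p i) + evalField (grad q) (p j)) +
      (1 / 2 : ℝ) • (p i ⨯₃ evalField w (p j) + p j ⨯₃ evalField w (p i)),
      fun i j => by simp only [add_comm], fun μ hμ => ?_, fun _ d hd => ?_⟩
    · simp only [smul_add _ (_ • _) (_ • _), Finset.sum_add_distrib, hcross, hgrad]
      rw [hμ, one_smul, evalField_add, evalField_cross, evalField_posField,
        evalField_baryPoint hg hμ, evalField_baryPoint hw hμ]
    · simp only [smul_add _ (_ • _) (_ • _), Finset.sum_add_distrib, hcross, hgrad]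
      rw [hd, zero_smul, zero_add, dotProduct_comm, dot_self_cross]
  · obtain ⟨V, hV, h⟩ := exists_bernstein_of_quadratic
      (add_mem hg (cross_mem_polyFieldDeg hw)) p
    exact ⟨V, hV, h, fun h => by omega⟩

/-! ### The edge moments -/

theorem dotProduct_self_nonneg (a : Vec) : 0 ≤ a ⬝ᵥ a :=
  Finset.sum_nonneg fun i _ => mul_self_nonneg (a i)

theorem bary_pow_mem_polyDeg (p : Fin 4 → Vec) (i : Fin 4) (m : ℕ) :
    bary p i ^ m ∈ polyDeg m := by
  induction m with
  | zero => exact C_mem_polyDeg le_rfl 1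
  | succ m ih =>
    rw [pow_succ, Nat.cast_succ]
    exact mul_mem_polyDeg ih (bary_mem_polyDeg p i)

/-- On an edge the tangential component of the field is a quadratic polynomial in one variable, and
the edge moments against the powers of a barycentric coordinate make its coefficients vanish. -/
theorem bernstein_orthogonal_edge (hp : AffineIndependent ℝ p) {k : ℕ} (hk : k = 1 ∨ k = 2)
    {t : Edge → Vec} (ht : IsUnitTangents p t) {v : PolyField} {V : Fin 4 → Fin 4 → Vec}
    (hsymm : ∀ i j, V i j = V j i)
    (hv : ∀ i j, ∀ s : ℝ, i ≠ j → evalField v (p i + s • (p j - p i)) =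
      (1 - s) ^ 2 • V i i + (2 * (s * (1 - s))) • V i j + s ^ 2 • V j j)
    (hred : k = 1 → ∀ i j, i ≠ j → (V i i - (2 : ℝ) • V i j + V j j) ⬝ᵥ (p j - p i) = 0)
    (hdof : ∀ e, ∀ q ∈ polyDeg k, edgeDof p e (t e) v q = 0) (i j : Fin 4) (hij : i ≠ j) :
    V i i ⬝ᵥ (p j - p i) = 0 ∧ V i j ⬝ᵥ (p j - p i) = 0 := by
  have key (i j : Fin 4) (hij : i < j) : V i i ⬝ᵥ (p j - p i) = 0 ∧ V i j ⬝ᵥ (p j - p i) = 0 ∧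
      V j j ⬝ᵥ (p j - p i) = 0 := by
    obtain ⟨ht1, c, hc⟩ := ht ⟨(i, j), hij⟩
    have hc0 : c * ((p j - p i) ⬝ᵥ (p j - p i)) ≠ 0 := by
      intro h0
      rw [hc, smul_dotProduct, dotProduct_smul, smul_eq_mul, smul_eq_mul, h0, mul_zero] at ht1
      exact zero_ne_one ht1
    have hsqrt : √((p j - p i) ⬝ᵥ (p j - p i)) ≠ 0 := by
      refine (Real.sqrt_ne_zero (dotProduct_self_nonneg _)).2 ?_
      exact right_ne_zero_of_mul hc0
    refine quadratic_eq_zero_of_moments hk (fun h => ?_) (fun m hm => ?_)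
    · have := hred h i j hij.ne
      simpa only [add_dotProduct, sub_dotProduct, smul_dotProduct, smul_eq_mul] using this
    · have h := hdof ⟨(i, j), hij⟩ (bary p j ^ m)
        (polyDeg_mono (by exact_mod_cast hm) (bary_pow_mem_polyDeg p j m))
      rw [edgeDof, edgeIntegral] at h
      have h := (mul_eq_zero.1 h).resolve_left hsqrt
      refine (mul_eq_zero.1 (Eq.trans ?_ h)).resolve_left (left_ne_zero_of_mul hc0)
      rw [← intervalIntegral.integral_const_mul]
      refine intervalIntegral.integral_congr fun s _ => ?_
      simp only [hv i j s hij.ne, hc, map_pow, eval_bary_edge hp, Pi.single_eq_same,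
        Pi.single_eq_of_ne hij.ne', add_dotProduct, smul_dotProduct, dotProduct_smul, smul_eq_mul]
      ring
  rcases lt_or_gt_of_ne hij with h | h
  · exact ⟨(key i j h).1, (key i j h).2.1⟩
  · obtain ⟨-, h1, h2⟩ := key j i h
    rw [← neg_sub, dotProduct_neg, dotProduct_neg, h2, hsymm, h1]
    simp

/-! ### The face moments -/

theorem dotProduct_facePoint_sub {n : Fin 4 → Vec} (hn : IsUnitNormals p n) (i : Fin 4) (s r : ℝ)
    (j : Fin 3) : n i ⬝ᵥ (facePoint p i s r - faceVertex p i j) = 0 := by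
  have h1 := (hn i).2 1 0
  have h2 := (hn i).2 2 0
  have h3 := (hn i).2 0 j
  rw [facePoint, add_right_comm, add_sub_right_comm, add_sub_right_comm]
  simp only [dotProduct_add, dotProduct_smul, h1, h2, h3]
  simp

theorem faceCross_ne_zero (hp : AffineIndependent ℝ p) (i : Fin 4) : faceCross p i ≠ 0 :=
  fun h => faceCross_triple_ne_zero hp i (by rw [h, dotProduct_zero])

theorem triangleIntegral_eq_zero_of_faceIntegral (hp : AffineIndependent ℝ p) {i : Fin 4}
    {f : Vec → ℝ} (h : faceIntegral p i f = 0) :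
    triangleIntegral (fun s r => f (facePoint p i s r)) = 0 := by
  rw [faceIntegral_eq] at h
  refine (mul_eq_zero.1 h).resolve_left ?_
  rw [← ne_eq, Real.sqrt_ne_zero (dotProduct_self_nonneg _), ne_eq, dotProduct_self_eq_zero]
  exact faceCross_ne_zero hp i

/-- The moment of `v × n` against `τ × n`, for `τ` tangential, is the moment of `v` against `τ`. -/
theorem triangleIntegral_eq_zero_of_faceDof (hp : AffineIndependent ℝ p) {n : Fin 4 → Vec}
    (hn : IsUnitNormals p n) {i : Fin 4} {v τ : PolyField}
    (hτ : ∀ s r, n i ⬝ᵥ evalField τ (facePoint p i s r) = 0)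
    (h : faceDof p i (n i) v (τ ⨯₃ constField (n i)) = 0) :
    triangleIntegral (fun s r =>
      evalField v (facePoint p i s r) ⬝ᵥ evalField τ (facePoint p i s r)) = 0 := by
  refine Eq.trans (congrArg triangleIntegral (funext₂ fun s r => ?_))
    (triangleIntegral_eq_zero_of_faceIntegral hp h)
  rw [evalField_cross, evalField_constField, cross_dot_cross, hτ, (hn i).1]
  ring

theorem constField_cross_mem_rmField (a n : Vec) (m : ℤ) :
    constField a ⨯₃ constField n ∈ rmField m n := by
  refine Submodule.mem_sup_left ⟨a ⨯₃ n, ?_, evalField_injective fun x => by simp⟩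
  rw [dotProduct_comm, dot_cross_self]

theorem sub_cross_mem_rmField (a n : Vec) :
    (posField - constField a) ⨯₃ constField n ∈ rmField 0 n := by
  rw [map_sub, LinearMap.sub_apply]
  refine sub_mem ?_ (constField_cross_mem_rmField a n 0)
  rw [← cross_anticomm]
  exact neg_mem (Submodule.mem_sup_right ⟨1, C_mem_polyDeg le_rfl 1, one_smul Poly (posPerp n)⟩)

theorem facePoint_eq_sum (i : Fin 4) (s r : ℝ) :
    facePoint p i s r = ∑ h, (![1 - s - r, s, r] : Fin 3 → ℝ) h • faceVertex p i h := by
  rw [facePoint, Fin.sum_univ_three]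
  simp only [Matrix.cons_val]
  module

/-- The face moments, against the test fields `τ × n` with `τ` an edge vector of the face for
`k = 1`, and `τ` the position relative to a vertex for `k = 2`. -/
theorem bernstein_orthogonal_face (hp : AffineIndependent ℝ p) {k : ℕ} (hk : k = 1 ∨ k = 2)
    {n : Fin 4 → Vec} (hn : IsUnitNormals p n) {v : PolyField} {V : Fin 4 → Fin 4 → Vec}
    (hsymm : ∀ i j, V i j = V j i) (hdiag : ∀ i, V i i = 0)
    (hedge : ∀ i j, i ≠ j → V i j ⬝ᵥ (p j - p i) = 0) (i : Fin 4)
    (hv : ∀ s r, evalField v (facePoint p i s r) =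
      ∑ m, ∑ l, ((![1 - s - r, s, r] : Fin 3 → ℝ) m * (![1 - s - r, s, r] : Fin 3 → ℝ) l) •
        V (i.succAbove m) (i.succAbove l))
    (hred : k = 1 → ∀ d : Fin 3 → ℝ, ∑ m, d m = 0 →
      (∑ m, ∑ l, (d m * d l) • V (i.succAbove m) (i.succAbove l)) ⬝ᵥ
        (∑ h, d h • faceVertex p i h) = 0)
    (hdof : ∀ q ∈ rmField ((k : ℤ) - 2) (n i), faceDof p i (n i) v q = 0) (m l h : Fin 3) :
    V (i.succAbove m) (i.succAbove l) ⬝ᵥ (p (i.succAbove h) - p (i.succAbove m)) = 0 := by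
  refine triangle_coeff_eq_zero hk (faceVertex p i)
    (fun m l => V (i.succAbove m) (i.succAbove l)) (fun m l => hsymm _ _) (fun m => hdiag _)
    (fun m l => ?_) hred (fun _ j => ?_) (fun h2 j => ?_) m l h
  · by_cases hml : m = l
    · rw [hml, sub_self, dotProduct_zero]
    · exact hedge _ _ (fun h => hml (Fin.succAbove_right_injective h))
  · have := triangleIntegral_eq_zero_of_faceDof hp hn (v := v)
      (τ := constField (faceVertex p i j - faceVertex p i 0)) (i := i)
      (fun s r => by rw [evalField_constField]; exact (hn i).2 j 0)
      (hdof _ (constField_cross_mem_rmField _ _ _))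
    simpa only [hv, evalField_constField] using this
  · subst h2
    have := triangleIntegral_eq_zero_of_faceDof hp hn (v := v)
      (τ := posField - constField (faceVertex p i j)) (i := i)
      (fun s r => by simpa using dotProduct_facePoint_sub hn i s r j)
      (hdof _ (by simpa using sub_cross_mem_rmField _ _))
    simp only [hv, evalField_sub, evalField_constField, evalField_posField] at this
    simpa only [facePoint_eq_sum] using this

/-! ### The face moments of the curl -/

/-- With the product of the barycentric coordinates `β` of the triangle as weight, the moments of
`β_m β_l` take two values, the ratio of the one for `m = l` to the other being `3 : 2`. The three
equations so obtained, one for each `j`, imply those asserted here. -/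
theorem sum_dotProduct_eq_zero_of_weighted_moments (P u : Fin 3 → Vec)
    (h : ∀ j, triangleIntegral (fun s r => (1 - s - r) * s * r *
      ((∑ m, ![1 - s - r, s, r] m • u m) ⬝ᵥ (∑ l, ![1 - s - r, s, r] l • P l - P j))) = 0)
    (j : Fin 3) : ∑ m, u m ⬝ᵥ (P m - P j) = 0 := by
  have key (j : Fin 3) : 3 * ∑ m, u m ⬝ᵥ (P m - P j) + 2 * (
      (u 0 ⬝ᵥ (P 1 - P j) + u 1 ⬝ᵥ (P 0 - P j)) + (u 0 ⬝ᵥ (P 2 - P j) + u 2 ⬝ᵥ (P 0 - P j)) +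
      (u 1 ⬝ᵥ (P 2 - P j) + u 2 ⬝ᵥ (P 1 - P j))) = 0 := by
    have hj := h j
    have e (s r : ℝ) : (1 - s - r) * s * r *
        ((∑ m, ![1 - s - r, s, r] m • u m) ⬝ᵥ (∑ l, ![1 - s - r, s, r] l • P l - P j)) =
        (u 0 ⬝ᵥ (P 0 - P j) * ((1 - s - r) ^ 3 * s ^ 1 * r ^ 1) +
          u 1 ⬝ᵥ (P 1 - P j) * ((1 - s - r) ^ 1 * s ^ 3 * r ^ 1) +
          u 2 ⬝ᵥ (P 2 - P j) * ((1 - s - r) ^ 1 * s ^ 1 * r ^ 3)) +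
        ((u 0 ⬝ᵥ (P 1 - P j) + u 1 ⬝ᵥ (P 0 - P j)) * ((1 - s - r) ^ 2 * s ^ 2 * r ^ 1) +
          (u 0 ⬝ᵥ (P 2 - P j) + u 2 ⬝ᵥ (P 0 - P j)) * ((1 - s - r) ^ 2 * s ^ 1 * r ^ 2) +
          (u 1 ⬝ᵥ (P 2 - P j) + u 2 ⬝ᵥ (P 1 - P j)) * ((1 - s - r) ^ 1 * s ^ 2 * r ^ 2)) := by
      simp only [Fin.sum_univ_three, Matrix.cons_val, dotProduct_sub, dotProduct_add,
        add_dotProduct, smul_dotProduct, dotProduct_smul, smul_eq_mul]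
      ring
    simp only [e] at hj
    rw [triangleIntegral_add (by unfold Function.uncurry; fun_prop)
      (by unfold Function.uncurry; fun_prop), triangleIntegral_combination_monomial,
      triangleIntegral_combination_monomial] at hj
    norm_num [Nat.factorial] at hj
    simp only [Fin.sum_univ_three, dotProduct_sub]
    linarith
  have k0 := key 0
  have k1 := key 1
  have k2 := key 2
  fin_cases j <;>
    simp only [Fin.sum_univ_three, dotProduct_sub, Fin.zero_eta, Fin.mk_one, Fin.reduceFinMk] at * <;>
    linarith

theorem facePoint_eq_baryPoint (i : Fin 4) (s r : ℝ) :
    facePoint p i s r = baryPoint p (i.insertNth 0 ![1 - s - r, s, r]) ∧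
      ∑ j, (i.insertNth 0 ![1 - s - r, s, r] : Fin 4 → ℝ) j = 1 := by
  constructor
  · rw [baryPoint, Fin.sum_univ_succAbove _ i, facePoint_eq_sum]
    simp [faceVertex]
  · rw [Fin.sum_univ_succAbove _ i, Fin.sum_univ_three]
    simp
    ring

theorem posTang_sub_mem_rtField (a n : Vec) (hn : n ⬝ᵥ n = 1) :
    posTang n - constField (a - (a ⬝ᵥ n) • n) ∈ rtField n := by
  refine sub_mem (Submodule.mem_sup_right ⟨1, C_mem_polyDeg le_rfl 1, one_smul Poly _⟩)
    (Submodule.mem_sup_left ⟨_, ?_, rfl⟩)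
  rw [sub_dotProduct, smul_dotProduct, hn]
  simp

/-- The test field on the face `i` is the tangential part of `x - p j` for a vertex `p j` of the
face, which turns the moment into `∫_F b_F u · (x - p j)` up to a nonzero factor. -/
theorem eq_zero_of_curl_moments (hp : AffineIndependent ℝ p) {n : Fin 4 → Vec}
    (hn : IsUnitNormals p n) {u : PolyField} (hu : u ∈ polyFieldDeg 1)
    (hdof : ∀ i, ∀ q ∈ rtField (n i), faceDof p i (n i) (curl (bubble p • u)) q = 0) : u = 0 := by
  have face (i : Fin 4) (j : Fin 3) : ∑ m : Fin 3, evalField u (p (i.succAbove m)) ⬝ᵥ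
      (p (i.succAbove m) - p (i.succAbove j)) = 0 := by
    refine sum_dotProduct_eq_zero_of_weighted_moments (faceVertex p i)
      (fun m => evalField u (p (i.succAbove m))) (fun j => ?_) j
    obtain ⟨c, hc, hnc⟩ := exists_normal_eq_smul_baryGrad hp hn i
    have h := triangleIntegral_eq_zero_of_faceIntegral hp
      (hdof i _ (posTang_sub_mem_rtField (faceVertex p i j) (n i) (hn i).1))
    refine (mul_eq_zero.1 (Eq.trans ?_ h)).resolve_left (inv_ne_zero hc)
    rw [← triangleIntegral_const_mul]
    refine congrArg triangleIntegral (funext₂ fun s r => ?_)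
    obtain ⟨hf, hs⟩ := facePoint_eq_baryPoint (p := p) i s r
    have hx : eval (facePoint p i s r) (bary p i) = 0 := by
      rw [hf, eval_bary_baryPoint hp hs, Fin.insertNth_apply_same]
    have hb : eval (facePoint p i s r) (faceBubble p i) = (1 - s - r) * s * r := by
      rw [faceBubble, map_prod, Fin.prod_univ_three, hf]
      simp [eval_bary_baryPoint hp hs]
    have hux : evalField u (facePoint p i s r) =
        ∑ m, (![1 - s - r, s, r] : Fin 3 → ℝ) m • evalField u (p (i.succAbove m)) := by
      rw [hf, evalField_baryPoint hu hs, Fin.sum_univ_succAbove _ i]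
      simp
    have hq : evalField (posTang (n i) -
        constField (faceVertex p i j - (faceVertex p i j ⬝ᵥ n i) • n i)) (facePoint p i s r) =
        facePoint p i s r - faceVertex p i j := by
      have h0 := dotProduct_facePoint_sub hn i s r j
      rw [dotProduct_comm, sub_dotProduct, sub_eq_zero] at h0
      rw [posTang, evalField_sub, evalField_sub, evalField_polySmul, eval_dotProduct,
        evalField_posField, evalField_constField, evalField_constField, h0]
      module
    have hg : baryGrad p i = c⁻¹ • n i := by rw [hnc, smul_smul, inv_mul_cancel₀ hc, one_smul]
    rw [hq, evalField_curl_bubble_smul hx, hb, ← hux, ← facePoint_eq_sum, hg]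
    simp only [map_smul, LinearMap.smul_apply, smul_dotProduct, smul_eq_mul]
    rw [cross_cross_eq_smul_sub_smul, sub_dotProduct, smul_dotProduct, smul_dotProduct,
      dotProduct_facePoint_sub hn, (hn i).1]
    simp
    ring
  have key (i j : Fin 4) : evalField u (p i) ⬝ᵥ (p i - p j) = 0 := by
    let U : Fin 4 → ℝ := fun i => evalField u (p i) ⬝ᵥ (p i - p j)
    have hj : U j = 0 := by simp [U]
    have h (i : Fin 4) (hi : i ≠ j) : U i = ∑ l, U l := by
      obtain ⟨m, rfl⟩ := Fin.exists_succAbove_eq hi.symm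
      rw [Fin.sum_univ_succAbove _ i]
      exact (add_eq_left.2 (face i m)).symm
    have hS : ∑ l, U l = 0 := by
      have h1 := Fin.sum_univ_succAbove U j
      simp only [h _ (Fin.succAbove_ne j _), hj, Finset.sum_const, Finset.card_univ,
        Fintype.card_fin, nsmul_eq_mul] at h1
      push_cast at h1
      linarith
    by_cases hi : i = j
    · rw [hi, sub_self, dotProduct_zero]
    · exact (h i hi).trans hS
  refine eq_zero_of_evalField_vertices hp hu fun j => ?_
  refine eq_zero_of_dotProduct_edges hp j fun l _ => ?_
  rw [← neg_sub, dotProduct_neg, key, neg_zero]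

/-! ### Unisolvence -/

theorem eval_bubble_edge (hp : AffineIndependent ℝ p) {i j : Fin 4} (s : ℝ) :
    eval (p i + s • (p j - p i)) (bubble p) = 0 := by
  obtain ⟨l, hli, hlj⟩ : ∃ l : Fin 4, l ≠ i ∧ l ≠ j := by
    revert i j
    decide
  apply eval_bubble_of_face (i := l)
  rw [eval_bary_edge hp, Pi.single_eq_of_ne hli, Pi.single_eq_of_ne hlj]
  simp

theorem sum_pair_smul {E : Type*} [AddCommGroup E] [Module ℝ E] (i j : Fin 4) (a b : ℝ)
    (F : Fin 4 → E) :
    ∑ l, (Pi.single i a + Pi.single j b : Fin 4 → ℝ) l • F l = a • F i + b • F j := by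
  simp [Pi.single_apply, add_smul, Finset.sum_add_distrib]

theorem sum_pair_mul_smul {V : Fin 4 → Fin 4 → Vec} (hsymm : ∀ i j, V i j = V j i) (i j : Fin 4)
    (a b : ℝ) :
    ∑ l, ∑ m, ((Pi.single i a + Pi.single j b : Fin 4 → ℝ) l *
      (Pi.single i a + Pi.single j b : Fin 4 → ℝ) m) • V l m =
      a ^ 2 • V i i + (2 * (a * b)) • V i j + b ^ 2 • V j j := by
  simp only [mul_smul, ← Finset.smul_sum, sum_pair_smul, hsymm j i]
  module

/-- The moments determine the elements of `W_k(K)`. -/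
theorem eq_zero_of_dofs (hp : AffineIndependent ℝ p) {k : ℕ} (hk : k = 1 ∨ k = 2)
    {t : Edge → Vec} {n : Fin 4 → Vec} (ht : IsUnitTangents p t) (hn : IsUnitNormals p n)
    {v : PolyField} (hv : v ∈ shapeSpace p k)
    (hE : ∀ e, ∀ q ∈ polyDeg k, edgeDof p e (t e) v q = 0)
    (hF : ∀ i, ∀ q ∈ rmField ((k : ℤ) - 2) (n i), faceDof p i (n i) v q = 0)
    (hC : ∀ i, ∀ q ∈ rtField (n i), faceDof p i (n i) (curl v) q = 0) : v = 0 := by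
  obtain ⟨_, hgc, _, hb, rfl⟩ := Submodule.mem_sup.1 hv
  obtain ⟨_, hg, _, hc, rfl⟩ := Submodule.mem_sup.1 hgc
  obtain ⟨q, hq, rfl⟩ := mem_gradSpace.1 hg
  obtain ⟨w, hw, rfl⟩ := mem_crossSpace.1 hc
  obtain ⟨u, hu, rfl⟩ := mem_bubbleSpace.1 hb
  obtain ⟨V, hsymm, hV, hred⟩ := exists_bernstein hk hq hw p
  have hedge := bernstein_orthogonal_edge hp hk ht hsymm
    (v := grad q + posField ⨯₃ w + bubble p • u) (fun i j s hij => ?_) (fun h i j hij => ?_) hE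
  rotate_left
  · have hsum : ∑ l, (Pi.single i (1 - s) + Pi.single j s : Fin 4 → ℝ) l = 1 := by
      simp [Finset.sum_add_distrib]
    have hpt : p i + s • (p j - p i) = baryPoint p (Pi.single i (1 - s) + Pi.single j s) := by
      rw [baryPoint, sum_pair_smul]
      module
    rw [evalField_add, evalField_polySmul, eval_bubble_edge hp, zero_smul, add_zero, hpt,
      hV _ hsum, sum_pair_mul_smul hsymm, mul_comm s]
  · have := hred h (Pi.single i (-1) + Pi.single j 1) (by simp [Finset.sum_add_distrib])
    rw [baryPoint, sum_pair_smul, sum_pair_mul_smul hsymm] at this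
    rw [← this]
    congr 1 <;> module
  have hdiag (i : Fin 4) : V i i = 0 :=
    eq_zero_of_dotProduct_edges hp i fun l hl => (hedge i l hl.symm).1
  have hface (i : Fin 4) := bernstein_orthogonal_face hp hk hn hsymm hdiag
    (fun i j hij => (hedge i j hij).2) i (v := grad q + posField ⨯₃ w + bubble p • u)
    (fun s r => by
      obtain ⟨hf, hs⟩ := facePoint_eq_baryPoint (p := p) i s r
      rw [evalField_add, evalField_polySmul, eval_bubble_of_face (i := i), zero_smul, add_zero, hf,
        hV _ hs]
      · simp [Fin.sum_univ_succAbove _ i]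
      · rw [hf, eval_bary_baryPoint hp hs, Fin.insertNth_apply_same])
    (fun h d hd => by
      have := hred h (i.insertNth 0 d) (by simpa [Fin.sum_univ_succAbove _ i] using hd)
      simpa [Fin.sum_univ_succAbove _ i, baryPoint, faceVertex] using this)
    (hF i)
  have hV0 (i j : Fin 4) : V i j = 0 := by
    by_cases hij : i = j
    · rw [hij, hdiag]
    refine eq_zero_of_dotProduct_edges hp i fun l hl => ?_
    by_cases hlj : l = j
    · rw [hlj]
      exact (hedge i j hij).2
    · obtain ⟨a, hai, haj, hal⟩ : ∃ a : Fin 4, i ≠ a ∧ j ≠ a ∧ l ≠ a := by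
        clear hlj hij hl
        revert i j l
        decide
      -- The three distinct vertices are those of the face opposite to the fourth one.
      obtain ⟨i, rfl⟩ := Fin.exists_succAbove_eq hai
      obtain ⟨j, rfl⟩ := Fin.exists_succAbove_eq haj
      obtain ⟨l, rfl⟩ := Fin.exists_succAbove_eq hal
      exact hface a i j l
  have h0 : grad q + posField ⨯₃ w = 0 := evalField_injective fun x => by
    obtain ⟨μ, hμ, rfl⟩ := exists_eq_baryPoint hp x
    rw [hV μ hμ]
    simp [hV0]
  rw [h0, zero_add] at hC ⊢
  rw [eq_zero_of_curl_moments hp hn hu hC, smul_zero]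

end QuadCurl

end

theorem mainTheorem4 (p : Fin 4 → QuadCurl.Vec) (hp : AffineIndependent ℝ p)
    (k : ℕ) (hk : k = 1 ∨ k = 2) :
    iSupIndep ![QuadCurl.gradSpace k, QuadCurl.crossSpace, QuadCurl.bubbleSpace p] ∧
    Module.finrank ℝ (QuadCurl.shapeSpace p k) = (if k = 1 then 32 else 42) ∧
    (∀ (t : QuadCurl.Edge → QuadCurl.Vec) (n : Fin 4 → QuadCurl.Vec),
      QuadCurl.IsUnitTangents p t → QuadCurl.IsUnitNormals p n →
        QuadCurl.Unisolvent p k t n (QuadCurl.shapeSpace p k)) ∧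
    Set.InjOn QuadCurl.curl
      (QuadCurl.crossSpace ⊔ QuadCurl.bubbleSpace p : Submodule ℝ QuadCurl.PolyField) := by
  have hdim : Module.finrank ℝ (QuadCurl.shapeSpace p k) = if k = 1 then 32 else 42 := by
    have h1 := QuadCurl.finrank_shapeSpace hp k
    have h2 := QuadCurl.finrank_gradSpace_add_one k
    rcases hk with rfl | rfl
    · norm_num [Nat.choose] at h2 ⊢
      omega
    · norm_num [Nat.choose] at h2 ⊢
      omega
  refine ⟨QuadCurl.iSupIndep_shape hp k, hdim, fun t n ht hn => ?_, QuadCurl.curl_injOn hp⟩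
  refine QuadCurl.unisolvent_of_injective hp hn ?_
    (fun v hv hE hF hC => QuadCurl.eq_zero_of_dofs hp hk ht hn hv hE hF hC)
  rw [hdim]
  rcases hk with rfl | rfl
  · rw [show ((1 : ℕ) : ℤ) - 2 = -1 by norm_num, QuadCurl.finrank_polyDeg_neg_one]
    norm_num
  · rw [show ((2 : ℕ) : ℤ) - 2 = (0 : ℕ) by norm_num, QuadCurl.finrank_polyDeg]
    norm_num
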